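/- **Setting.** Let $\mathcal N$ be a finite nonempty set of $N$ agents and $\Theta$ a finite set of $M$ parameters with true parameter $\theta^*\in\Theta$. Agent $i$ has a convex compact strategy set $\mathcal X_i\subset\mathbb R^{d_i}$; $\mathcal X=\prod_i\mathcal X_i$. Its cost is $u_i:\mathcal X\times\Theta\to\mathbb R$, and its realized cost at $(x,\theta)$ is $u_i(x,\theta)$ plus a zero-mean noise and has the probability density $f_i(\cdot\,|x,\theta)$ with respect to a fixed $\sigma$-finite measure on $\mathbb R$ (e.g. Lebesgue measure). For $m\in\Delta(\Theta)$ put $u_i(x,m)=\sum_\theta m(\theta)u_i(x,\theta)$ and $\mathrm{BR}_i(x_{-i},m)=\arg\min_{x_i\in\mathcal X_i}u_i(x_i,x_{-i},m)$. A Nash equilibrium under the common belief $m$ is a profile $x^*(m)\in\mathcal X$ with $x_i^*(m)\in \mathrm{BR}_i(x_{-i}^*(m),m)$ for all $i$. **Algorithm.** Let $W=[w_{ij}]$ be a weight matrix and $(\alpha^{(t)})_{t\ge0}$ a non-increasing step-size sequence. Start from $x^{(0)}\in\mathcal X$ and $\mu_i^{(0)}$ uniform on $\Theta$. At time $t$,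 conditionally on $x^{(0)},\dots,x^{(t)}$ and $y^{(0)},\dots,y^{(t-1)}$, the realized costs $(y_j^{(t)})_{j}$ have the distribution $\prod_j f_j(\cdot\,|x^{(t)},\theta^*)$, and $$b_i^{(t)}(\theta)=\frac{f_i(y_i^{(t)}|x^{(t)},\theta)^{\alpha^{(t)}}\mu_i^{(t)}(\theta)}{\sum_{\theta'}f_i(y_i^{(t)}|x^{(t)},\theta')^{\alpha^{(t)}}\mu_i^{(t)}(\theta')},\qquad \mu_i^{(t+1)}(\theta)=\frac{\exp\big(\sum_jw_{ij}\log b_j^{(t)}(\theta)\big)}{\sum_{\theta'}\exp\big(\sum_jw_{ij}\log b_j^{(t)}(\theta')\big)},$$ $$x_i^{(t+1)}\in(1-\alpha^{(t)})x_i^{(t)}+\alpha^{(t)}\mathrm{BR}_i\big(x_{-i}^{(t)},\mu_i^{(t+1)}\big).$$ **Assumptions.** 1. There is $L>0$ with $\big|\log\frac{f_i(y|x,\theta')}{f_i(y|x,\theta'')}\big|\le L$ for all $i,y,\theta',\theta''$ and $x\in\mathcal X$ (where one of the likelihoods $f_i(y|x,\cdot)$ vanishes, all do, and nothing is required), and $x\mapsto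 f_i(y|x,\theta)$ is continuous on $\mathcal X$. 2. For every $\theta\ne\theta^*$ there is an agent $i$ with $D_{KL}(f_i(\cdot|x,\theta^*)\|f_i(\cdot|x,\theta))>0$ for all $x\in\mathcal X$. 3. The undirected communication graph on $\mathcal N$ (loops allowed) is connected, $W$ is doubly stochastic, and $w_{ij}>0$ if and only if $(j,i)$ is an edge. 4. $0<\alpha^{(t)}<1$, $\sum_t\alpha^{(t)}=\infty$, $\sum_t(\alpha^{(t)})^2<\infty$. 5. $u_i(\cdot,\theta)$ is continuous on $\mathcal X$ and strictly convex in $x_i$, for all $i,\theta$. 6. Almost surely, if $\mu$ is the common limit of the belief sequences $(\mu_i^{(t)})_t$, then there is a Nash equilibrium $x^*(\mu)$ under $\mu$ such that every solution $\bar x:[0,\infty)\to\mathcal X$ of $\dot{\bar x}_i(t)\in\mathrm{BR}_i(\bar x_{-i}(t),\mu)-\bar x_i(t)$ $(i\in\mathcal N)$, from any initial profile in $\mathcal X$, converges to $x^*(\mu)$ as $t\to\infty$. **Theorem 3.** Under Assumptions 1–6, almost surely all belief sequences $(\mu_i^{(t)})_t$ converge to a common belief $\mu\in\Delta(\Theta)$,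 there is exactly one Nash equilibrium $x^*(\mu)$ under $\mu$, and, with the (finite) network divergence $$Z(\theta^*,\theta_k)=\frac1N\sum_{j}D_{KL}\big(f_j(\cdot|x^*(\mu),\theta^*)\,\|\,f_j(\cdot|x^*(\mu),\theta_k)\big)$$ and $s^{(T)}=\sum_{t=1}^T\alpha^{(t)}$, the following hold for every agent $i$: - for every $\theta_k\in\Theta$, $\displaystyle\lim_{T\to\infty}\frac1{s^{(T)}}\log\frac{\mu_i^{(T+1)}(\theta^*)}{\mu_i^{(T+1)}(\theta_k)}=Z(\theta^*,\theta_k)$; - $Z(\theta^*,\theta_k)>0$ for every $\theta_k\neq\theta^*$; - $\mu_i^{(t)}(\theta^*)\to1$ as $t\to\infty$; - for every $\epsilon>0$ there is a (random) $T'$ such that for all $T\ge T'$, $$\frac1{1+\sum_{\theta_k\ne\theta^*}\exp\big(-s^{(T)}(Z(\theta^*,\theta_k)-\epsilon)\big)}\le\mu_i^{(T+1)}(\theta^*)\le1 .$$ -/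

import Mathlib

open MeasureTheory ProbabilityTheory Filter Topology

noncomputable section

namespace LearningGame

/-- Strategy profiles `x = col{x₁, …, x_N}`, agent `i` choosing a vector of `ℝ^(d i)`. -/
abbrev Profile {ι : Type*} (d : ι → ℕ) : Type _ :=
  (i : ι) → EuclideanSpace ℝ (Fin (d i))

/-- The data of a stage game with an unknown parameter in `Θ`: strategy sets, costs, and the
likelihoods `f i y x θ` of the realized costs, as densities with respect to a reference measure
`ref i` on `ℝ` (the Lebesgue measure, say). -/
structure Game (ι Θ : Type*) (d : ι → ℕ) where
  strat : (i : ι) → Set (EuclideanSpace ℝ (Fin (d i)))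
  cost : ι → Profile d → Θ → ℝ
  ref : ι → Measure ℝ
  f : ι → ℝ → Profile d → Θ → ℝ

variable {ι Θ Ω : Type*} {d : ι → ℕ}

namespace Game

/-- The set of strategy profiles `𝒳 = ∏ i, 𝒳 i`. -/
def profiles (G : Game ι Θ d) : Set (Profile d) :=
  {x | ∀ i, x i ∈ G.strat i}

/-- The distribution of the realized cost of agent `i` at the profile `x` and parameter `θ`. -/
def law (G : Game ι Θ d) (i : ι) (x : Profile d) (θ : Θ) : Measure ℝ :=
  (G.ref i).withDensity fun y => ENNReal.ofReal (G.f i y x θ)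

/-- The standing conventions on the stage game: strategy sets are convex and compact, the
likelihoods are probability densities, and the realized cost is the cost plus a noise of zero
mean, that is, its distribution has mean `cost i x θ`. -/
structure IsModel (G : Game ι Θ d) : Prop where
  convex_strat : ∀ i, Convex ℝ (G.strat i)
  compact_strat : ∀ i, IsCompact (G.strat i)
  sigmaFinite_ref : ∀ i, SigmaFinite (G.ref i)
  f_nonneg : ∀ i y, ∀ x ∈ G.profiles, ∀ θ, 0 ≤ G.f i y x θ
  f_measurable : ∀ i, ∀ x ∈ G.profiles, ∀ θ, Measurable fun y => G.f i y x θ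
  law_prob : ∀ i, ∀ x ∈ G.profiles, ∀ θ, IsProbabilityMeasure (G.law i x θ)
  noise_integrable : ∀ i, ∀ x ∈ G.profiles, ∀ θ, Integrable (fun y => y) (G.law i x θ)
  noise_mean : ∀ i, ∀ x ∈ G.profiles, ∀ θ, ∫ y, y ∂(G.law i x θ) = G.cost i x θ

/-- Bounded information content and continuity of the likelihoods. The first clause says that
the likelihood ratios are meaningful: if one of the likelihoods of a signal vanishes then so do
all the others (and then the ratio `0 / 0` imposes no bound). -/
structure BoundedInformation (G : Game ι Θ d) : Prop where
  common_support : ∀ i y, ∀ x ∈ G.profiles, ∀ θ' θ'', G.f i y x θ'' = 0 → G.f i y x θ' = 0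
  bounded : ∃ L : ℝ, 0 < L ∧ ∀ i, ∀ θ' θ'', ∀ x ∈ G.profiles, ∀ y,
    |Real.log (G.f i y x θ' / G.f i y x θ'')| ≤ L
  continuous : ∀ i y θ, ContinuousOn (fun x => G.f i y x θ) G.profiles

/-- Global identifiability of the true parameter. -/
def Identifiable (G : Game ι Θ d) (θs : Θ) : Prop :=
  ∀ θ, θ ≠ θs → ∃ i, ∀ x ∈ G.profiles,
    0 < InformationTheory.klDiv (G.law i x θs) (G.law i x θ)

/-- Costs are continuous in the profile and strictly convex in the own strategy. -/
structure ConvexCosts [DecidableEq ι] (G : Game ι Θ d) : Prop where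
  continuous : ∀ i θ, ContinuousOn (fun x => G.cost i x θ) G.profiles
  strictConvex : ∀ i θ, ∀ x ∈ G.profiles,
    StrictConvexOn ℝ (G.strat i) fun z => G.cost i (Function.update x i z) θ

/-- Expected cost under a belief `m` on the parameter. -/
def expCost [Fintype Θ] (G : Game ι Θ d) (i : ι) (x : Profile d) (m : Θ → ℝ) : ℝ :=
  ∑ θ, m θ * G.cost i x θ

/-- The best responses of agent `i` to the strategies `x_{-i}` of the others under the belief
`m`; the coordinate `x i` plays no role. -/
def bestResponse [Fintype Θ] [DecidableEq ι] (G : Game ι Θ d) (i : ι) (x : Profile d)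
    (m : Θ → ℝ) : Set (EuclideanSpace ℝ (Fin (d i))) :=
  {z | z ∈ G.strat i ∧ ∀ z' ∈ G.strat i,
    G.expCost i (Function.update x i z) m ≤ G.expCost i (Function.update x i z') m}

/-- Nash equilibria of the game with the common belief `m`. -/
def IsNash [Fintype Θ] [DecidableEq ι] (G : Game ι Θ d) (m : Θ → ℝ) (x : Profile d) : Prop :=
  x ∈ G.profiles ∧ ∀ i, ∀ z ∈ G.strat i,
    G.expCost i x m ≤ G.expCost i (Function.update x i z) m

/-- `xbar`, on `[0, ∞)`, is a solution in the set of profiles of the best-response dynamics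
`d xbar_i / dt ∈ BR_i(xbar_{-i}(t), m) - xbar_i(t)`. -/
def IsBRSolution [Fintype Θ] [DecidableEq ι] (G : Game ι Θ d) (m : Θ → ℝ)
    (xbar : ℝ → Profile d) : Prop :=
  ∀ t, 0 ≤ t → xbar t ∈ G.profiles ∧ ∀ i, ∃ z ∈ G.bestResponse i (xbar t) m,
    HasDerivWithinAt (fun s => xbar s i) (z - xbar t i) (Set.Ici 0) t

/-- Every solution of the best-response dynamics under the common belief `m`, from any initial
profile, converges to the Nash equilibrium of the game with the common belief `m`. -/
def BRConverges [Fintype Θ] [DecidableEq ι] (G : Game ι Θ d) (m : Θ → ℝ) : Prop :=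
  ∃ xs, G.IsNash m xs ∧ ∀ xbar, G.IsBRSolution m xbar → Tendsto xbar atTop (𝓝 xs)

/-- The network divergence `Z(θ*, θ)` at the profile `x`. -/
def networkDivergence [Fintype ι] (G : Game ι Θ d) (x : Profile d) (θs θ : Θ) : ENNReal :=
  (∑ j, InformationTheory.klDiv (G.law j x θs) (G.law j x θ)) / (Fintype.card ι : ENNReal)

end Game

/-- A connected undirected communication graph with edge relation `E` (loops are allowed) and a
doubly stochastic weight matrix `W` supported on its edges. -/
structure IsNetwork [Fintype ι] [DecidableEq ι] (E : ι → ι → Prop) (W : Matrix ι ι ℝ) :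
    Prop where
  symm : ∀ i j, E i j → E j i
  connected : ∀ i j, Relation.ReflTransGen E i j
  doublyStochastic : W ∈ doublyStochastic ℝ ι
  pos_iff : ∀ i j, 0 < W i j ↔ E j i

/-- Step sizes: non-increasing, in `(0, 1)`, not summable, square summable. -/
structure IsStepSize (α : ℕ → ℝ) : Prop where
  antitone : Antitone α
  mem_Ioo : ∀ t, α t ∈ Set.Ioo (0 : ℝ) 1
  sum_eq_top : Tendsto (fun T => ∑ t ∈ Finset.range T, α t) atTop atTop
  sq_summable : Summable fun t => α t ^ 2

/-- Tempered Bayesian update, with exponent `a`, of a belief `m` by the likelihoods `ℓ`. -/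
def posterior [Fintype Θ] (a : ℝ) (ℓ m : Θ → ℝ) (θ : Θ) : ℝ :=
  ℓ θ ^ a * m θ / ∑ θ', ℓ θ' ^ a * m θ'

/-- Geometric averaging of the posteriors `b j` with weights `w j`. -/
def pool [Fintype ι] [Fintype Θ] (w : ι → ℝ) (b : ι → Θ → ℝ) (θ : Θ) : ℝ :=
  Real.exp (∑ j, w j * Real.log (b j θ)) / ∑ θ', Real.exp (∑ j, w j * Real.log (b j θ'))

/-- The beliefs `belief t i θ = μ_i^(t)(θ)` computed by the algorithm along a trajectory `x` of
profiles and `y` of realized costs. -/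
def belief [Fintype ι] [Fintype Θ] (G : Game ι Θ d) (W : Matrix ι ι ℝ) (α : ℕ → ℝ)
    (x : ℕ → Profile d) (y : ℕ → ι → ℝ) : ℕ → ι → Θ → ℝ
  | 0 => fun _ _ => 1 / (Fintype.card Θ : ℝ)
  | t + 1 => fun i =>
      pool (W i) fun j =>
        posterior (α t) (fun θ => G.f j (y t j) (x t) θ) (belief G W α x y t j)

/-- The past at the time when the costs of period `t` are realized: the profiles of the periods
`0, …, t` and the realized costs of the periods `0, …, t - 1`. -/
@[reducible]
def history (x : ℕ → Ω → Profile d) (y : ℕ → Ω → ι → ℝ) (t : ℕ) : MeasurableSpace Ω :=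
  (⨆ s ∈ Set.Iic t, MeasurableSpace.comap (x s) inferInstance) ⊔
    ⨆ s ∈ Set.Iio t, MeasurableSpace.comap (y s) inferInstance

/-- The random profiles `x t` and realized costs `y t` are generated by the learning algorithm
when the true parameter is `θs`. -/
structure IsRun [Fintype ι] [DecidableEq ι] [Fintype Θ] [MeasurableSpace Ω] (P : Measure Ω)
    (G : Game ι Θ d) (W : Matrix ι ι ℝ) (α : ℕ → ℝ) (θs : Θ)
    (x : ℕ → Ω → Profile d) (y : ℕ → Ω → ι → ℝ) : Prop where
  measurable_x : ∀ t, Measurable (x t)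
  measurable_y : ∀ t, Measurable (y t)
  init_mem : ∀ ω, x 0 ω ∈ G.profiles
  /-- Given the past, the realized costs have the distribution `∏ j, f j (· | x t, θs)`. -/
  cond_law : ∀ (t : ℕ) (B : ι → Set ℝ), (∀ i, MeasurableSet (B i)) →
    P[Set.indicator {ω | ∀ i, y t ω i ∈ B i} (fun _ => (1 : ℝ)) | history x y t]
      =ᵐ[P] fun ω => ∏ i, (G.law i (x t ω) θs).real (B i)
  /-- The best-response update of the strategies with the updated private beliefs. -/
  strategy_update : ∀ (ω : Ω) (t : ℕ) (i : ι),
    ∃ z ∈ G.bestResponse i (x t ω)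
        (belief G W α (fun s => x s ω) (fun s => y s ω) (t + 1) i),
      x (t + 1) ω i = (1 - α t) • x t ω i + α t • z

end LearningGame

end

open LearningGame

open scoped BigOperators Matrix

/-!
The log-odds of a belief obey a linear recursion: at each step the agents add the weighted
log-likelihood ratios of their signals and average the result with `W`. The noise of the signals
contributes a martingale whose second moments stay bounded, because doubly stochastic averaging does
not increase the sum of squares; it is negligible against the diverging sum of the step sizes. The
conditional means of the signals are continuous in the strategies, hence vary slowly, and summation
by parts against the fundamental matrix of `W` shows that they spread evenly over the network. By
compactness and identifiability their averages are bounded below, so beliefs concentrate at `θs`.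

The strategies then follow the best responses to a converging belief with vanishing steps: limits of
windows of their paths solve the best-response differential inclusion and approach the Nash
equilibrium, so most of any long window is spent near it. Time averages of the mean information
therefore converge to its value there, the network divergence, which is the rate of the log-odds.
-/

noncomputable section

namespace LearningGame

section StochasticMatrices

variable {ι : Type*} [Fintype ι]

variable (ι) in
/-- The matrix `J` which replaces each coordinate of a vector by the mean of the coordinates. -/
def averagingMatrix : Matrix ι ι ℝ := Matrix.of fun _ _ => (Fintype.card ι : ℝ)⁻¹

theorem averagingMatrix_mulVec (v : ι → ℝ) : averagingMatrix ι *ᵥ v = fun _ => 𝔼 i, v i := by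
  ext i
  simp [averagingMatrix, Matrix.mulVec, dotProduct, ← Finset.mul_sum,
    Fintype.expect_eq_sum_div_card, div_eq_inv_mul]

theorem averagingMatrix_mul_self [Nonempty ι] :
    averagingMatrix ι * averagingMatrix ι = averagingMatrix ι := by
  ext i j
  simp [averagingMatrix, Matrix.mul_apply]

variable [DecidableEq ι] {W : Matrix ι ι ℝ}

theorem norm_mulVec_le_of_mem_rowStochastic (hW : W ∈ Matrix.rowStochastic ℝ ι) (v : ι → ℝ) :
    ‖W *ᵥ v‖ ≤ ‖v‖ := by
  refine (pi_norm_le_iff_of_nonneg (norm_nonneg _)).2 fun i => ?_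
  calc ‖(W *ᵥ v) i‖ ≤ ∑ j, ‖W i j * v j‖ := norm_sum_le _ _
    _ ≤ ∑ j, W i j * ‖v‖ := by
        refine Finset.sum_le_sum fun j _ => ?_
        have h0 : 0 ≤ W i j := Matrix.nonneg_of_mem_rowStochastic hW
        rw [norm_mul, Real.norm_of_nonneg h0]
        exact mul_le_mul_of_nonneg_left (norm_le_pi_norm v j) h0
    _ = ‖v‖ := by rw [← Finset.sum_mul, Matrix.sum_row_of_mem_rowStochastic hW, one_mul]

theorem sum_sq_mulVec_le_of_mem_doublyStochastic (hW : W ∈ doublyStochastic ℝ ι) (v : ι → ℝ) :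
    ∑ i, (W *ᵥ v) i ^ 2 ≤ ∑ i, v i ^ 2 := by
  calc ∑ i, (W *ᵥ v) i ^ 2 ≤ ∑ i, ∑ j, W i j * v j ^ 2 := by
        refine Finset.sum_le_sum fun i _ => ?_
        have jensen := (even_two.convexOn_pow (𝕜 := ℝ)).map_sum_le (t := Finset.univ) (w := W i)
          (p := v) (fun j _ => nonneg_of_mem_doublyStochastic hW)
          (sum_row_of_mem_doublyStochastic hW i) (fun _ _ => Set.mem_univ _)
        simpa [Matrix.mulVec, dotProduct] using jensen
    _ = ∑ j, v j ^ 2 := by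
        rw [Finset.sum_comm]
        simp [← Finset.sum_mul, sum_col_of_mem_doublyStochastic hW]

theorem averagingMatrix_mul (hW : W ∈ Matrix.colStochastic ℝ ι) :
    averagingMatrix ι * W = averagingMatrix ι := by
  ext i j
  simp [averagingMatrix, Matrix.mul_apply, ← Finset.mul_sum,
    Matrix.sum_col_of_mem_colStochastic hW]

theorem mul_averagingMatrix (hW : W ∈ Matrix.rowStochastic ℝ ι) :
    W * averagingMatrix ι = averagingMatrix ι := by
  ext i j
  simp [averagingMatrix, Matrix.mul_apply, ← Finset.sum_mul,
    Matrix.sum_row_of_mem_rowStochastic hW]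

/-- The fundamental matrix of the Markov chain `W`, in the sense of Kemeny and Snell, the uniform
distribution being stationary. -/
def fundamentalMatrix (W : Matrix ι ι ℝ) : Matrix ι ι ℝ := (1 - W + averagingMatrix ι)⁻¹

end StochasticMatrices

namespace IsNetwork

variable {ι : Type*} [Fintype ι] [DecidableEq ι] {E : ι → ι → Prop} {W : Matrix ι ι ℝ}

theorem rowStochastic (h : IsNetwork E W) : W ∈ Matrix.rowStochastic ℝ ι :=
  (mem_doublyStochastic_iff_mem_rowStochastic_and_mem_colStochastic.1 h.doublyStochastic).1

theorem colStochastic (h : IsNetwork E W) : W ∈ Matrix.colStochastic ℝ ι :=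
  (mem_doublyStochastic_iff_mem_rowStochastic_and_mem_colStochastic.1 h.doublyStochastic).2

theorem eq_of_isMax_of_mulVec_eq (h : IsNetwork E W) {v : ι → ℝ} (hv : W *ᵥ v = v) {a b : ι}
    (ha : ∀ c, v c ≤ v a) (hab : E a b) : v b = v a := by
  have hw : 0 < W a b := (h.pos_iff a b).2 (h.symm _ _ hab)
  have hterm : ∀ c, 0 ≤ W a c * (v a - v c) := fun c =>
    mul_nonneg (nonneg_of_mem_doublyStochastic h.doublyStochastic) (sub_nonneg.2 (ha c))
  have hsum : ∑ c, W a c * (v a - v c) = 0 := by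
    have hva : ∑ c, W a c * v c = v a := congrFun hv a
    simp only [mul_sub, Finset.sum_sub_distrib, ← Finset.sum_mul,
      sum_row_of_mem_doublyStochastic h.doublyStochastic, hva, one_mul, sub_self]
  have hb := (Finset.sum_eq_zero_iff_of_nonneg fun c _ => hterm c).1 hsum b (Finset.mem_univ b)
  linarith [(mul_eq_zero.1 hb).resolve_left hw.ne']

theorem eq_of_mulVec_eq (h : IsNetwork E W) {v : ι → ℝ} (hv : W *ᵥ v = v) (i j : ι) :
    v i = v j := by
  have : Nonempty ι := ⟨i⟩
  obtain ⟨m, hm⟩ := Finite.exists_max v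
  have hconst : ∀ b, v b = v m := fun b => by
    induction h.connected m b with
    | refl => rfl
    | tail _ hab ih => exact (h.eq_of_isMax_of_mulVec_eq hv (ih ▸ hm) hab).trans ih
  rw [hconst i, hconst j]

variable [Nonempty ι]

theorem averagingMatrix_mul_one_sub_add (h : IsNetwork E W) :
    averagingMatrix ι * (1 - W + averagingMatrix ι) = averagingMatrix ι := by
  rw [mul_add, mul_sub, mul_one, averagingMatrix_mul h.colStochastic, averagingMatrix_mul_self,
    sub_self, zero_add]

theorem isUnit_one_sub_add_averagingMatrix (h : IsNetwork E W) :
    IsUnit (1 - W + averagingMatrix ι) := by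
  rw [← Matrix.mulVec_injective_iff_isUnit, ← Matrix.coe_mulVecLin, ← LinearMap.ker_eq_bot,
    LinearMap.ker_eq_bot']
  intro v hv
  rw [Matrix.mulVecLin_apply] at hv
  have hJ : averagingMatrix ι *ᵥ v = 0 := by
    rw [← h.averagingMatrix_mul_one_sub_add, ← Matrix.mulVec_mulVec, hv, Matrix.mulVec_zero]
  have hW : W *ᵥ v = v := by
    rw [Matrix.add_mulVec, hJ, add_zero, Matrix.sub_mulVec, Matrix.one_mulVec] at hv
    exact (sub_eq_zero.1 hv).symm
  ext i
  calc v i = 𝔼 j, v j := by simp [h.eq_of_mulVec_eq hW _ i]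
    _ = 0 := congrFun ((averagingMatrix_mulVec v).symm.trans hJ) i

theorem one_sub_mul_fundamentalMatrix (h : IsNetwork E W) :
    (1 - W) * fundamentalMatrix W = 1 - averagingMatrix ι := by
  have hdet := (Matrix.isUnit_iff_isUnit_det _).1 h.isUnit_one_sub_add_averagingMatrix
  have hinv : (1 - W + averagingMatrix ι) * fundamentalMatrix W = 1 :=
    Matrix.mul_nonsing_inv _ hdet
  have hJ : averagingMatrix ι * fundamentalMatrix W = averagingMatrix ι := by
    nth_rewrite 1 [← h.averagingMatrix_mul_one_sub_add]
    rw [mul_assoc, hinv, mul_one]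
  rw [add_mul, hJ] at hinv
  exact eq_sub_of_add_eq hinv

end IsNetwork

/-- The time elapsed before period `k` when period `t` lasts `α t`. -/
def clock (α : ℕ → ℝ) (k : ℕ) : ℝ := ∑ t ∈ Finset.range k, α t

theorem IsStepSize.nonneg {α : ℕ → ℝ} (hα : IsStepSize α) (t : ℕ) : 0 ≤ α t := (hα.mem_Ioo t).1.le

theorem IsStepSize.tendsto_clock {α : ℕ → ℝ} (hα : IsStepSize α) :
    Tendsto (clock α) atTop atTop := hα.sum_eq_top

theorem tendsto_weighted_average {α b : ℕ → ℝ} {l : ℝ} (hα : ∀ t, 0 ≤ α t)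
    (hs : Tendsto (clock α) atTop atTop)
    (hb : Tendsto b atTop (𝓝 l)) :
    Tendsto (fun T => (∑ t ∈ Finset.range T, α t * b t) / clock α T) atTop (𝓝 l) := by
  have hsmall : (fun t => α t * (b t - l)) =o[atTop] α := by
    have hbl : (fun t => b t - l) =o[atTop] fun _ => (1 : ℝ) := by
      rw [Asymptotics.isLittleO_one_iff]
      simpa using hb.sub_const l
    simpa using (Asymptotics.isBigO_refl α atTop).mul_isLittleO hbl
  have hlim := (hsmall.sum_range hα hs).tendsto_div_nhds_zero.add_const l
  rw [zero_add] at hlim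
  refine hlim.congr' ?_
  filter_upwards [hs.eventually_gt_atTop 0] with T hT
  simp only [mul_sub, Finset.sum_sub_distrib, ← Finset.sum_mul]
  rw [← clock.eq_def α, sub_div, mul_div_cancel_left₀ _ hT.ne', sub_add_cancel]

/-- Accumulation of the signals `r t`, weighted by `α t` and averaged over the network. -/
def diffuse {ι : Type*} [Fintype ι] (W : Matrix ι ι ℝ) (α : ℕ → ℝ) (r : ℕ → ι → ℝ) : ℕ → ι → ℝ
  | 0 => 0
  | t + 1 => W *ᵥ (diffuse W α r t + α t • r t)

section Diffusion

variable {ι : Type*} [Fintype ι] {W : Matrix ι ι ℝ} {α : ℕ → ℝ}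

theorem diffuse_add (W : Matrix ι ι ℝ) (α : ℕ → ℝ) (r r' : ℕ → ι → ℝ) (t : ℕ) :
    diffuse W α (r + r') t = diffuse W α r t + diffuse W α r' t := by
  induction t with
  | zero => simp [diffuse]
  | succ t ih =>
    simp only [diffuse, ih, Pi.add_apply, smul_add, ← Matrix.mulVec_add]
    congr 1
    abel

theorem mulVec_diffuse_of_commute {A : Matrix ι ι ℝ} (hA : Commute A W) (α : ℕ → ℝ)
    (r : ℕ → ι → ℝ) (T : ℕ) : A *ᵥ diffuse W α r T = diffuse W α (fun t => A *ᵥ r t) T := by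
  induction T with
  | zero => simp [diffuse]
  | succ t ih =>
    rw [diffuse, diffuse, Matrix.mulVec_mulVec, hA.eq, ← Matrix.mulVec_mulVec, Matrix.mulVec_add,
      Matrix.mulVec_smul, ih]

theorem mulVec_diffuse_of_mul_eq {A : Matrix ι ι ℝ} (hA : A * W = A) (α : ℕ → ℝ)
    (r : ℕ → ι → ℝ) (T : ℕ) :
    A *ᵥ diffuse W α r T = ∑ t ∈ Finset.range T, α t • A *ᵥ r t := by
  induction T with
  | zero => simp [diffuse]
  | succ t ih =>
    rw [diffuse, Matrix.mulVec_mulVec, hA, Matrix.mulVec_add, ih, Matrix.mulVec_smul,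
      Finset.sum_range_succ]

variable [DecidableEq ι]

theorem norm_diffuse_le (hW : W ∈ Matrix.rowStochastic ℝ ι) (α : ℕ → ℝ) (r : ℕ → ι → ℝ) (T : ℕ) :
    ‖diffuse W α r T‖ ≤ ∑ t ∈ Finset.range T, ‖α t • r t‖ := by
  induction T with
  | zero => simp [diffuse]
  | succ t ih =>
    rw [diffuse, Finset.sum_range_succ]
    exact (norm_mulVec_le_of_mem_rowStochastic hW _).trans ((norm_add_le _ _).trans (by gcongr))

-- Summation by parts: up to the correction `α T • W *ᵥ h T`, each step of the diffusion of
-- `h - W *ᵥ h` only adds the increments of `α` and of `h`.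
theorem norm_diffuse_sub_mulVec_sub_le (hW : W ∈ Matrix.rowStochastic ℝ ι) (hα : Antitone α)
    (hα0 : ∀ t, 0 ≤ α t) {h : ℕ → ι → ℝ} {H : ℝ} (hH : ∀ t, ‖h t‖ ≤ H) (T : ℕ) :
    ‖diffuse W α (fun t => h t - W *ᵥ h t) T - α T • W *ᵥ h T‖ ≤
      (2 * α 0 - α T) * H + ∑ t ∈ Finset.range T, α t * ‖h (t + 1) - h t‖ := by
  induction T with
  | zero =>
    have h0 := (norm_mulVec_le_of_mem_rowStochastic hW (h 0)).trans (hH 0)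
    simp only [diffuse, zero_sub, norm_neg, norm_smul, Real.norm_of_nonneg (hα0 0),
      Finset.range_zero, Finset.sum_empty, add_zero, two_mul, add_sub_cancel_right]
    exact mul_le_mul_of_nonneg_left h0 (hα0 0)
  | succ t ih =>
    have hd : 0 ≤ α t - α (t + 1) := sub_nonneg.2 (hα t.le_succ)
    set e := diffuse W α (fun t => h t - W *ᵥ h t)
    have hrec : e (t + 1) - α (t + 1) • W *ᵥ h (t + 1) = W *ᵥ (e t - α t • W *ᵥ h t +
        ((α t - α (t + 1)) • h (t + 1) - α t • (h (t + 1) - h t))) := by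
      simp only [e, diffuse, Matrix.mulVec_add, Matrix.mulVec_sub, Matrix.mulVec_smul, smul_sub,
        sub_smul]
      abel
    have hincr : ‖(α t - α (t + 1)) • h (t + 1) - α t • (h (t + 1) - h t)‖ ≤
        (α t - α (t + 1)) * H + α t * ‖h (t + 1) - h t‖ := by
      refine (norm_sub_le _ _).trans ?_
      rw [norm_smul, norm_smul, Real.norm_of_nonneg hd, Real.norm_of_nonneg (hα0 t)]
      gcongr
      exact hH _
    rw [hrec, Finset.sum_range_succ]
    refine (norm_mulVec_le_of_mem_rowStochastic hW _).trans ((norm_add_le _ _).trans ?_)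
    linarith

theorem norm_diffuse_sub_mulVec_le (hW : W ∈ Matrix.rowStochastic ℝ ι) (hα : Antitone α)
    (hα0 : ∀ t, 0 ≤ α t) {h : ℕ → ι → ℝ} {H : ℝ} (hH : ∀ t, ‖h t‖ ≤ H) (T : ℕ) :
    ‖diffuse W α (fun t => h t - W *ᵥ h t) T‖ ≤
      2 * α 0 * H + ∑ t ∈ Finset.range T, α t * ‖h (t + 1) - h t‖ := by
  have hcorr : ‖α T • W *ᵥ h T‖ ≤ α T * H := by
    rw [norm_smul, Real.norm_of_nonneg (hα0 T)]
    exact mul_le_mul_of_nonneg_left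
      ((norm_mulVec_le_of_mem_rowStochastic hW _).trans (hH T)) (hα0 T)
  have hmain := norm_diffuse_sub_mulVec_sub_le hW hα hα0 hH T
  linarith [norm_le_norm_sub_add (diffuse W α (fun t => h t - W *ᵥ h t) T) (α T • W *ᵥ h T)]

/-- With `h` the image of `g` under the fundamental matrix, `g t` deviates from its network average
by `h t - W *ᵥ h t`. The powers of `W` themselves need not converge on a periodic network. -/
theorem IsNetwork.tendsto_diffuse_sub_average [Nonempty ι] {E : ι → ι → Prop}
    (hE : IsNetwork E W) (hα : IsStepSize α) {g : ℕ → ι → ℝ} {C : ℝ} (hC : ∀ t, ‖g t‖ ≤ C)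
    (hg : Tendsto (fun t => g (t + 1) - g t) atTop (𝓝 0)) :
    Tendsto (fun T => (clock α T)⁻¹ • ((1 - averagingMatrix ι) *ᵥ diffuse W α g T))
      atTop (𝓝 0) := by
  have hclock0 : ∀ T, 0 ≤ clock α T := fun T => Finset.sum_nonneg fun t _ => hα.nonneg t
  let B : (ι → ℝ) →L[ℝ] (ι → ℝ) := (fundamentalMatrix W).mulVecLin.toContinuousLinearMap
  set h : ℕ → ι → ℝ := fun t => B (g t)
  have hH : ∀ t, ‖h t‖ ≤ ‖B‖ * C := fun t => B.le_opNorm_of_le (hC t)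
  have hcenter : ∀ T, (1 - averagingMatrix ι) *ᵥ diffuse W α g T =
      diffuse W α (fun t => h t - W *ᵥ h t) T := fun T => by
    have hcomm : Commute (1 - averagingMatrix ι) W := by
      rw [Commute, SemiconjBy, sub_mul, mul_sub, averagingMatrix_mul hE.colStochastic,
        mul_averagingMatrix hE.rowStochastic, one_mul, mul_one]
    rw [mulVec_diffuse_of_commute hcomm, ← hE.one_sub_mul_fundamentalMatrix]
    simp only [← Matrix.mulVec_mulVec, Matrix.sub_mulVec, Matrix.one_mulVec]
    rfl
  have hincr : Tendsto (fun t => ‖h (t + 1) - h t‖) atTop (𝓝 0) := by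
    simpa only [h, ← map_sub, Function.comp_def, map_zero, norm_zero] using
      ((B.continuous.tendsto 0).comp hg).norm
  have hlim := (hα.tendsto_clock.const_div_atTop (2 * α 0 * (‖B‖ * C))).add
    (tendsto_weighted_average hα.nonneg hα.tendsto_clock hincr)
  rw [add_zero] at hlim
  refine squeeze_zero_norm (fun T => ?_) hlim
  rw [hcenter, norm_smul, norm_inv, Real.norm_of_nonneg (hclock0 T), inv_mul_eq_div, ← add_div]
  exact div_le_div_of_nonneg_right
    (norm_diffuse_sub_mulVec_le hE.rowStochastic hα.antitone hα.nonneg hH T) (hclock0 T)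

end Diffusion

section Calculus

variable {V : Type*} [NormedAddCommGroup V] [NormedSpace ℝ V]

theorem exists_tendsto_of_isCompact {β X : Type*} [TopologicalSpace X] {K : Set X}
    (hK : IsCompact K) (U : Ultrafilter β) {u : β → X} (hu : ∀ n, u n ∈ K) :
    ∃ p ∈ K, Tendsto u U (𝓝 p) :=
  hK.ultrafilter_le_nhds' (U.map u) (Ultrafilter.mem_map.2 (Eventually.of_forall hu))

theorem hasDerivWithinAt_of_forall_norm_sub_le {ψ : ℝ → V} {q : V} {s : Set ℝ} {t : ℝ}
    (ht : t ∈ s)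
    (h : ∀ η > 0, ∃ δ > 0, ∀ a ∈ s, ∀ b ∈ s, a ≤ b → |a - t| < δ → |b - t| < δ →
      ‖ψ b - ψ a - (b - a) • q‖ ≤ η * (b - a)) :
    HasDerivWithinAt ψ q s t := by
  rw [hasDerivWithinAt_iff_isLittleO, Asymptotics.isLittleO_iff]
  intro η hη
  obtain ⟨δ, hδ, hδt⟩ := h η hη
  have htt : |t - t| < δ := by simpa using hδ
  filter_upwards [inter_mem_nhdsWithin s (Metric.ball_mem_nhds t hδ)] with r ⟨hr, hrt⟩
  rcases le_total t r with htr | hrt'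
  · rw [Real.norm_of_nonneg (sub_nonneg.2 htr)]
    exact hδt t ht r hr htr htt hrt
  · have hneg : ψ r - ψ t - (r - t) • q = -(ψ t - ψ r - (t - r) • q) := by module
    rw [Real.norm_of_nonpos (sub_nonpos.2 hrt'), neg_sub, hneg, norm_neg]
    exact hδt r hr t ht hrt' hrt htt

theorem eventually_lt_mul_of_tendsto_deriv_zero {ψ ψ' : ℝ → ℝ}
    (hψ : ∀ τ, 0 ≤ τ → HasDerivWithinAt ψ (ψ' τ) (Set.Ici 0) τ)
    (hψ' : Tendsto ψ' atTop (𝓝 0)) {ε : ℝ} (hε : 0 < ε) : ∀ᶠ τ in atTop, ψ τ < ε * τ := by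
  obtain ⟨τ₀, hτ₀, hsmall⟩ : ∃ τ₀ ≥ (0 : ℝ), ∀ τ ≥ τ₀, ‖ψ' τ‖ ≤ ε / 2 := by
    obtain ⟨τ₀, hτ₀⟩ := eventually_atTop.1
      (hψ'.norm.eventually (ge_mem_nhds (by rw [norm_zero]; positivity : ‖(0 : ℝ)‖ < ε / 2)))
    exact ⟨max τ₀ 0, le_max_right _ _, fun τ h => hτ₀ τ ((le_max_left _ _).trans h)⟩
  filter_upwards [eventually_ge_atTop τ₀,
    (tendsto_id.const_mul_atTop (half_pos hε)).eventually_gt_atTop (ψ τ₀)] with τ hτ hbig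
  have hmvt := (convex_Ici τ₀).norm_image_sub_le_of_norm_hasDerivWithin_le
    (fun r hr => (hψ r (hτ₀.trans hr)).mono (Set.Ici_subset_Ici.2 hτ₀)) hsmall
    Set.self_mem_Ici hτ
  rw [Real.norm_of_nonneg (sub_nonneg.2 hτ)] at hmvt
  have hle := (le_abs_self _).trans hmvt
  simp only [id_eq] at hbig
  nlinarith

end Calculus

section Clock

variable {α : ℕ → ℝ}

theorem clock_succ (α : ℕ → ℝ) (k : ℕ) : clock α (k + 1) = clock α k + α k :=
  Finset.sum_range_succ _ _

theorem clock_mono (hα : ∀ t, 0 ≤ α t) : Monotone (clock α) :=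
  monotone_nat_of_le_succ fun k => by rw [clock_succ]; linarith [hα k]

theorem sum_Ico_eq_clock_sub (α : ℕ → ℝ) {a b : ℕ} (hab : a ≤ b) :
    ∑ t ∈ Finset.Ico a b, α t = clock α b - clock α a :=
  Finset.sum_Ico_eq_sub _ hab

namespace IsStepSize

theorem tendsto_zero (hα : IsStepSize α) : Tendsto α atTop (𝓝 0) := by
  simpa [Real.sqrt_sq (hα.nonneg _)] using hα.sq_summable.tendsto_atTop_zero.sqrt

theorem exists_period (hα : IsStepSize α) (k : ℕ) (τ : ℝ) :
    ∃ j, k ≤ j ∧ τ ≤ clock α j - clock α k := by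
  obtain ⟨j, hj, hkj⟩ := ((hα.tendsto_clock.eventually_ge_atTop (τ + clock α k)).and
    (eventually_ge_atTop k)).exists
  exact ⟨j, hkj, by linarith⟩

open Classical in
/-- The first period `j ≥ k` at which a time `τ` has elapsed since period `k`. -/
def period (hα : IsStepSize α) (k : ℕ) (τ : ℝ) : ℕ := Nat.find (hα.exists_period k τ)

variable (hα : IsStepSize α) (k : ℕ) {τ τ' : ℝ}

include hα in
theorem clock_mono : Monotone (clock α) := LearningGame.clock_mono hα.nonneg

theorem le_period : k ≤ hα.period k τ := by
  classical exact (Nat.find_spec (hα.exists_period k τ)).1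

theorem le_clock_period : τ ≤ clock α (hα.period k τ) - clock α k := by
  classical exact (Nat.find_spec (hα.exists_period k τ)).2

theorem period_mono (h : τ ≤ τ') : hα.period k τ ≤ hα.period k τ' := by
  classical exact Nat.find_min' _ ⟨hα.le_period k, h.trans (hα.le_clock_period k)⟩

theorem clock_period_le : clock α (hα.period k τ) - clock α k ≤ |τ| + α k := by
  classical
  rcases (hα.le_period k (τ := τ)).eq_or_lt with hk | hk
  · rw [← hk, sub_self]
    exact add_nonneg (abs_nonneg τ) (hα.nonneg k)
  · obtain ⟨j, hj⟩ : ∃ j, hα.period k τ = j + 1 := ⟨hα.period k τ - 1, by omega⟩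
    have hkj : k ≤ j := by omega
    have hnot := Nat.find_min (hα.exists_period k τ) (show j < hα.period k τ by omega)
    have hlt : clock α j - clock α k < τ := not_le.1 fun hle => hnot ⟨hkj, hle⟩
    rw [hj, clock_succ]
    linarith [hα.antitone hkj, le_abs_self τ]

theorem tendsto_clock_period {β : Type*} {l : Filter β} {k : β → ℕ} (hk : Tendsto k l atTop)
    (h : 0 ≤ τ) :
    Tendsto (fun n => clock α (hα.period (k n) τ) - clock α (k n)) l (𝓝 τ) := by
  refine tendsto_of_tendsto_of_tendsto_of_le_of_le tendsto_const_nhds (h := fun n => τ + α (k n))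
    ?_ (fun n => hα.le_clock_period _) fun n => ?_
  · simpa using (hα.tendsto_zero.comp hk).const_add τ
  · simpa only [abs_of_nonneg h] using hα.clock_period_le (k n) (τ := τ)

theorem tendsto_clock_period_sub {β : Type*} {l : Filter β} {k : β → ℕ} (hk : Tendsto k l atTop)
    (h : 0 ≤ τ) (h' : 0 ≤ τ') :
    Tendsto (fun n => clock α (hα.period (k n) τ') - clock α (hα.period (k n) τ)) l
      (𝓝 (τ' - τ)) := by
  simpa only [sub_sub_sub_cancel_right] using
    (hα.tendsto_clock_period hk h').sub (hα.tendsto_clock_period hk h)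

end IsStepSize

/-- The covering argument: one splits the time up to period `T` into stretches, and only the last
one, which sticks out, is estimated crudely. -/
theorem clock_sub_le_of_forall_exists_stretch {c : ℕ → ℝ} (hα : ∀ t, 0 ≤ α t) {ε M R : ℝ} {K : ℕ}
    (hε : 0 ≤ ε) (hM : 0 ≤ M) (hc : ∀ t, c t ≤ M)
    (h : ∀ k ≥ K, ∃ k' > k, clock α k' - clock α k ≤ R ∧
      clock (α * c) k' - clock (α * c) k ≤ ε * (clock α k' - clock α k)) {T : ℕ} (hT : K ≤ T) :
    clock (α * c) T - clock (α * c) K ≤ ε * (clock α T - clock α K) + M * R := by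
  have hmono := clock_mono hα
  have hcrude : ∀ a b, a ≤ b →
      clock (α * c) b - clock (α * c) a ≤ M * (clock α b - clock α a) := fun a b hab => by
    rw [← sum_Ico_eq_clock_sub _ hab, ← sum_Ico_eq_clock_sub _ hab, Finset.mul_sum]
    exact Finset.sum_le_sum fun t _ => by
      rw [Pi.mul_apply, mul_comm]; exact mul_le_mul_of_nonneg_right (hc t) (hα t)
  suffices key : ∀ n k, K ≤ k → k ≤ T → T - k = n →
      clock (α * c) T - clock (α * c) k ≤ ε * (clock α T - clock α k) + M * R from
    key _ K le_rfl hT rfl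
  intro n
  induction n using Nat.strong_induction_on with
  | _ n ih =>
    intro k hk hkT hn
    obtain ⟨k', hkk', hR, hstretch⟩ := h k hk
    rcases le_or_gt k' T with hle | hlt
    · linarith [ih (T - k') (by omega) k' (by omega) hle rfl]
    · have hlast : M * (clock α T - clock α k) ≤ M * R :=
        mul_le_mul_of_nonneg_left (by linarith [hmono hlt.le]) hM
      linarith [hcrude k T hkT, mul_nonneg hε (sub_nonneg.2 (hmono hkT))]

end Clock

section Recursion

variable {V : Type*} [NormedAddCommGroup V] [NormedSpace ℝ V] {α : ℕ → ℝ} {s v : ℕ → V}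

theorem norm_sub_sub_smul_le (hα : ∀ t, 0 ≤ α t) (hs : ∀ t, s (t + 1) = s t + α t • v t) {q : V}
    {η : ℝ} {a b : ℕ} (hab : a ≤ b) (h : ∀ t ∈ Finset.Ico a b, ‖v t - q‖ ≤ η) :
    ‖s b - s a - (clock α b - clock α a) • q‖ ≤ η * (clock α b - clock α a) := by
  have hsum : s b - s a = ∑ t ∈ Finset.Ico a b, α t • v t := by
    rw [← Finset.sum_Ico_sub _ hab]
    exact Finset.sum_congr rfl fun t _ => by rw [hs, add_sub_cancel_left]
  rw [hsum, ← sum_Ico_eq_clock_sub α hab, Finset.sum_smul, ← Finset.sum_sub_distrib,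
    Finset.mul_sum]
  refine norm_sum_le_of_le _ fun t ht => ?_
  rw [← smul_sub, norm_smul, Real.norm_of_nonneg (hα t), mul_comm]
  exact mul_le_mul_of_nonneg_right (h t ht) (hα t)

theorem norm_sub_le_clock (hα : ∀ t, 0 ≤ α t) (hs : ∀ t, s (t + 1) = s t + α t • v t) {C : ℝ}
    (h : ∀ t, ‖v t‖ ≤ C) (a b : ℕ) : ‖s b - s a‖ ≤ C * |clock α b - clock α a| := by
  wlog hab : a ≤ b generalizing a b
  · rw [norm_sub_rev, abs_sub_comm]
    exact this b a (le_of_not_ge hab)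
  rw [abs_of_nonneg (sub_nonneg.2 (clock_mono hα hab))]
  simpa using norm_sub_sub_smul_le hα hs (q := 0) hab fun t _ => by simpa using h t

variable {Y : Type*} [PseudoMetricSpace Y] {x : ℕ → Y} {l : Filter ℕ} {k : ℕ → ℕ} {t : ℝ} {p : Y}
  {C : ℝ}

theorem eventually_forall_Ico_period (hα : IsStepSize α) (hC : 0 ≤ C)
    (hx : ∀ a b, dist (x b) (x a) ≤ C * |clock α b - clock α a|) (hk : Tendsto k l atTop)
    (ht : 0 ≤ t) (hp : Tendsto (fun n => x (hα.period (k n) t)) l (𝓝 p)) {A : ℕ → Prop}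
    (hA : ∀ᶠ j in atTop ⊓ comap x (𝓝 p), A j) :
    ∃ δ > 0, ∀ a b, 0 ≤ a → 0 ≤ b → |a - t| < δ → |b - t| < δ →
      ∀ᶠ n in l, ∀ j ∈ Finset.Ico (hα.period (k n) a) (hα.period (k n) b), A j := by
  obtain ⟨⟨K, ρ⟩, ⟨-, hρ⟩, hsub⟩ :=
    (atTop_basis.inf (Metric.nhds_basis_ball.comap x)).mem_iff.1 hA
  set δ := ρ / (2 * (C + 1))
  have hδ : 0 < δ := by positivity
  have hCδ : C * δ ≤ ρ / 2 := by
    have : (C + 1) * δ = ρ / 2 := by simp only [δ]; field_simp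
    linarith
  refine ⟨δ, hδ, fun a b ha hb hat hbt => ?_⟩
  filter_upwards [(hα.tendsto_clock_period_sub hk ht ha).abs.eventually (gt_mem_nhds hat),
    (hα.tendsto_clock_period_sub hk ht hb).abs.eventually (gt_mem_nhds hbt),
    hp.eventually (Metric.ball_mem_nhds p (half_pos hρ)), hk.eventually_ge_atTop K]
    with n hna hnb hnp hnK j hj
  obtain ⟨haj, hjb⟩ := Finset.mem_Ico.1 hj
  have hclock : |clock α j - clock α (hα.period (k n) t)| ≤ δ := by
    have hleft := hα.clock_mono haj
    have hright := hα.clock_mono hjb.le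
    rw [abs_lt] at hna hnb
    exact abs_le.2 ⟨by linarith, by linarith⟩
  refine hsub ⟨hnK.trans ((hα.le_period _).trans haj), ?_⟩
  calc dist (x j) p
      ≤ dist (x j) (x (hα.period (k n) t)) + dist (x (hα.period (k n) t)) p := dist_triangle _ _ _
    _ < ρ / 2 + ρ / 2 := by
        exact add_lt_add_of_le_of_lt
          ((hx _ _).trans ((mul_le_mul_of_nonneg_left hclock hC).trans hCδ)) hnp
    _ = ρ := add_halves ρ

theorem hasDerivWithinAt_limit [l.NeBot] (hα : IsStepSize α)
    (hs : ∀ t, s (t + 1) = s t + α t • v t) (hC : 0 ≤ C)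
    (hx : ∀ a b, dist (x b) (x a) ≤ C * |clock α b - clock α a|) (hk : Tendsto k l atTop)
    {ψ : ℝ → V} (hψ : ∀ a b,
      Tendsto (fun n => s (hα.period (k n) b) - s (hα.period (k n) a)) l (𝓝 (ψ b - ψ a)))
    (ht : 0 ≤ t) (hp : Tendsto (fun n => x (hα.period (k n) t)) l (𝓝 p)) {q : V}
    (hq : Tendsto v (atTop ⊓ comap x (𝓝 p)) (𝓝 q)) :
    HasDerivWithinAt ψ q (Set.Ici 0) t := by
  refine hasDerivWithinAt_of_forall_norm_sub_le ht fun η hη => ?_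
  obtain ⟨δ, hδ, hnear⟩ := eventually_forall_Ico_period hα hC hx hk ht hp
    (hq.eventually (Metric.closedBall_mem_nhds q hη))
  refine ⟨δ, hδ, fun a ha b hb hab hat hbt => ?_⟩
  have hclock := hα.tendsto_clock_period_sub hk ha hb
  refine le_of_tendsto_of_tendsto ((hψ a b).sub (hclock.smul_const q)).norm
    (hclock.const_mul η) ?_
  filter_upwards [hnear a b ha hb hat hbt] with n hn
  exact norm_sub_sub_smul_le hα.nonneg hs (hα.period_mono _ hab) fun j hj =>
    mem_closedBall_iff_norm.1 (hn j hj)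

end Recursion

section TimeAverages

theorem exists_forall_norm_sub_le {V : Type*} [SeminormedAddCommGroup V] {X : Set V}
    {x z : ℕ → V} (hX : IsCompact X) (hxX : ∀ t, x t ∈ X) (hzX : ∀ t, z t ∈ X) :
    ∃ C, ∀ t, ‖z t - x t‖ ≤ C := by
  obtain ⟨D, hD⟩ := hX.isBounded.exists_norm_le
  exact ⟨D + D, fun t => (norm_sub_le _ _).trans (add_le_add (hD _ (hzX t)) (hD _ (hxX t)))⟩

variable {V : Type*} [NormedAddCommGroup V] [NormedSpace ℝ V] {α : ℕ → ℝ} {x z : ℕ → V}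
  {X : Set V} {F : V → V} {k : ℕ → ℕ} {U : Ultrafilter ℕ}

theorem exists_limit_solution (hα : IsStepSize α) (hX : IsCompact X)
    (hxX : ∀ t, x t ∈ X) (hzX : ∀ t, z t ∈ X) (hx : ∀ t, x (t + 1) = x t + α t • (z t - x t))
    (hF : ∀ p ∈ X, Tendsto z (atTop ⊓ comap x (𝓝 p)) (𝓝 (F p))) (hk : Tendsto k U atTop) :
    ∃ φ : ℝ → V, (∀ τ, φ τ ∈ X) ∧
      (∀ τ, Tendsto (fun n => x (hα.period (k n) τ)) U (𝓝 (φ τ))) ∧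
      ∀ t, 0 ≤ t → HasDerivWithinAt φ (F (φ t) - φ t) (Set.Ici 0) t := by
  obtain ⟨C, hC⟩ := exists_forall_norm_sub_le hX hxX hzX
  choose φ hφX hφ using fun τ : ℝ =>
    exists_tendsto_of_isCompact hX U fun n => hxX (hα.period (k n) τ)
  exact ⟨φ, hφX, hφ, fun t ht =>
    hasDerivWithinAt_limit hα hx ((norm_nonneg _).trans (hC 0))
      (fun a b => (dist_eq_norm _ _).trans_le (norm_sub_le_clock hα.nonneg hx hC a b))
      hk (fun a b => (hφ b).sub (hφ a)) ht (hφ t)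
      ((hF _ (hφX t)).sub (tendsto_comap.mono_left inf_le_right))⟩

theorem exists_limit_clock (hα : IsStepSize α) {c : ℕ → ℝ} {M : ℝ} (hM : ∀ t, ‖c t‖ ≤ M)
    (U : Ultrafilter ℕ) (k : ℕ → ℕ) :
    ∃ ψ : ℝ → ℝ, ∀ τ, Tendsto
      (fun n => clock (α * c) (hα.period (k n) τ) - clock (α * c) (k n)) U (𝓝 (ψ τ)) := by
  have hM0 : 0 ≤ M := (norm_nonneg _).trans (hM 0)
  suffices h : ∀ τ, ∃ p, Tendsto
      (fun n => clock (α * c) (hα.period (k n) τ) - clock (α * c) (k n)) U (𝓝 p) from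
    ⟨_, fun τ => (h τ).choose_spec⟩
  intro τ
  obtain ⟨p, -, hp⟩ := exists_tendsto_of_isCompact (isCompact_closedBall 0 (M * (|τ| + 1))) U
    fun n => mem_closedBall_zero_iff.2 <|
      (norm_sub_le_clock hα.nonneg (clock_succ (α * c)) hM (k n) (hα.period (k n) τ)).trans <| by
        rw [abs_of_nonneg (sub_nonneg.2 (hα.clock_mono (hα.le_period _)))]
        have hα1 := (hα.mem_Ioo (k n)).2
        exact mul_le_mul_of_nonneg_left ((hα.clock_period_le _).trans (by linarith)) hM0
  exact ⟨p, hp⟩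

variable {xs : V} {c : V → ℝ}

theorem exists_pos_eventually_clock_lt (hα : IsStepSize α) (hX : IsCompact X)
    (hxX : ∀ t, x t ∈ X) (hzX : ∀ t, z t ∈ X) (hx : ∀ t, x (t + 1) = x t + α t • (z t - x t))
    (hF : ∀ p ∈ X, Tendsto z (atTop ⊓ comap x (𝓝 p)) (𝓝 (F p))) (hxs : xs ∈ X)
    (hsol : ∀ φ : ℝ → V, (∀ t, 0 ≤ t → φ t ∈ X ∧
      HasDerivWithinAt φ (F (φ t) - φ t) (Set.Ici 0) t) → Tendsto φ atTop (𝓝 xs))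
    (hc : ContinuousOn c X) (hcs : c xs = 0) {ε : ℝ} (hε : 0 < ε) (hk : Tendsto k U atTop) :
    ∃ τ > 0, ∀ᶠ n in U, clock (α * (c ∘ x)) (hα.period (k n) τ) - clock (α * (c ∘ x)) (k n) <
      ε * (clock α (hα.period (k n) τ) - clock α (k n)) := by
  obtain ⟨M, hM⟩ := hX.exists_bound_of_continuousOn hc
  obtain ⟨C, hC⟩ := exists_forall_norm_sub_le hX hxX hzX
  obtain ⟨φ, hφX, hφ, hφ'⟩ := exists_limit_solution hα hX hxX hzX hx hF hk
  obtain ⟨ψ, hψ⟩ := exists_limit_clock hα (c := c ∘ x) (fun t => hM _ (hxX t)) U k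
  have hψ' : ∀ t, 0 ≤ t → HasDerivWithinAt ψ (c (φ t)) (Set.Ici 0) t := fun t ht => by
    have hcx : Tendsto (c ∘ x) (atTop ⊓ comap x (𝓝 (φ t))) (𝓝 (c (φ t))) :=
      (hc _ (hφX t)).tendsto.comp (tendsto_nhdsWithin_iff.2
        ⟨tendsto_comap.mono_left inf_le_right, Eventually.of_forall hxX⟩)
    exact hasDerivWithinAt_limit hα (clock_succ (α * (c ∘ x))) ((norm_nonneg _).trans (hC 0))
      (fun a b => (dist_eq_norm _ _).trans_le (norm_sub_le_clock hα.nonneg hx hC a b)) hk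
      (fun a b => by simpa only [sub_sub_sub_cancel_right] using (hψ b).sub (hψ a)) ht (hφ t) hcx
  have hcφ : Tendsto (c ∘ φ) atTop (𝓝 0) := hcs ▸ (hc xs hxs).tendsto.comp
    (tendsto_nhdsWithin_iff.2 ⟨hsol φ fun t ht => ⟨hφX t, hφ' t ht⟩, Eventually.of_forall hφX⟩)
  obtain ⟨τ, hlt, hτ⟩ := ((eventually_lt_mul_of_tendsto_deriv_zero hψ' hcφ hε).and
    (eventually_gt_atTop 0)).exists
  exact ⟨τ, hτ, (hψ τ).eventually_lt ((hα.tendsto_clock_period hk hτ.le).const_mul ε) hlt⟩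

theorem exists_stretch (hα : IsStepSize α) (hX : IsCompact X)
    (hxX : ∀ t, x t ∈ X) (hzX : ∀ t, z t ∈ X) (hx : ∀ t, x (t + 1) = x t + α t • (z t - x t))
    (hF : ∀ p ∈ X, Tendsto z (atTop ⊓ comap x (𝓝 p)) (𝓝 (F p))) (hxs : xs ∈ X)
    (hsol : ∀ φ : ℝ → V, (∀ t, 0 ≤ t → φ t ∈ X ∧
      HasDerivWithinAt φ (F (φ t) - φ t) (Set.Ici 0) t) → Tendsto φ atTop (𝓝 xs))
    (hc : ContinuousOn c X) (hcs : c xs = 0) {ε : ℝ} (hε : 0 < ε) :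
    ∃ n : ℕ, ∀ k ≥ n, ∃ k' > k, clock α k' - clock α k ≤ n ∧
      clock (α * (c ∘ x)) k' - clock (α * (c ∘ x)) k ≤ ε * (clock α k' - clock α k) := by
  by_contra! hcon
  choose k hkn hk using hcon
  have hkt : Tendsto k (hyperfilter ℕ : Filter ℕ) atTop :=
    (tendsto_atTop_mono hkn tendsto_id).mono_left Nat.hyperfilter_le_atTop
  obtain ⟨τ, hτ, hlt⟩ :=
    exists_pos_eventually_clock_lt hα hX hxX hzX hx hF hxs hsol hc hcs hε hkt
  have hlarge : ∀ᶠ n : ℕ in (hyperfilter ℕ : Filter ℕ), τ + 1 ≤ n :=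
    ((tendsto_natCast_atTop_atTop (R := ℝ)).eventually_ge_atTop _).filter_mono
      Nat.hyperfilter_le_atTop
  obtain ⟨n, hn, hτn⟩ := (hlt.and hlarge).exists
  have hstrict : k n < hα.period (k n) τ := (hα.le_period (k n)).lt_of_ne fun h => by
    have hle := hα.le_clock_period (k n) (τ := τ)
    rw [← h, sub_self] at hle
    exact hle.not_gt hτ
  have hle : clock α (hα.period (k n) τ) - clock α (k n) ≤ n := by
    have hperiod := hα.clock_period_le (k n) (τ := τ)
    rw [abs_of_pos hτ] at hperiod
    linarith [(hα.mem_Ioo (k n)).2]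
  exact (hk n _ hstrict hle).not_gt hn

theorem tendsto_clock_div_of_forall_exists_stretch {c : ℕ → ℝ} (hα : ∀ t, 0 ≤ α t)
    (hs : Tendsto (clock α) atTop atTop) (hc0 : ∀ t, 0 ≤ c t) {M : ℝ} (hcM : ∀ t, c t ≤ M)
    (h : ∀ ε > 0, ∃ n : ℕ, ∀ k ≥ n, ∃ k' > k, clock α k' - clock α k ≤ n ∧
      clock (α * c) k' - clock (α * c) k ≤ ε * (clock α k' - clock α k)) :
    Tendsto (fun T => clock (α * c) T / clock α T) atTop (𝓝 0) := by
  have hclock0 : ∀ T, 0 ≤ clock (α * c) T := fun T =>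
    Finset.sum_nonneg fun t _ => mul_nonneg (hα t) (hc0 t)
  refine tendsto_order.2 ⟨fun r hr => ?_, fun ε hε => ?_⟩
  · filter_upwards [hs.eventually_gt_atTop 0] with T hT
    exact hr.trans_le (div_nonneg (hclock0 T) hT.le)
  obtain ⟨K, hK⟩ := h (ε / 2) (half_pos hε)
  have hrest : Tendsto (fun T => (clock (α * c) K + M * K) / clock α T) atTop (𝓝 0) :=
    hs.const_div_atTop _
  filter_upwards [hs.eventually_gt_atTop 0, eventually_ge_atTop K,
    hrest.eventually (gt_mem_nhds (half_pos hε))] with T hT hKT hlt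
  have hcover := clock_sub_le_of_forall_exists_stretch hα (half_pos hε).le
    ((hc0 0).trans (hcM 0)) hcM hK hKT
  have hKnonneg : 0 ≤ ε / 2 * clock α K :=
    mul_nonneg (half_pos hε).le (Finset.sum_nonneg fun t _ => hα t)
  rw [div_lt_iff₀ hT] at hlt ⊢
  linarith

/-- A point `xs` may attract all solutions without being stable, so `x` itself may keep leaving its
neighbourhoods; only the proportion of time spent away from `xs` vanishes. -/
theorem tendsto_time_average (hα : IsStepSize α) (hX : IsCompact X)
    (hxX : ∀ t, x t ∈ X) (hzX : ∀ t, z t ∈ X) (hx : ∀ t, x (t + 1) = x t + α t • (z t - x t))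
    (hF : ∀ p ∈ X, Tendsto z (atTop ⊓ comap x (𝓝 p)) (𝓝 (F p))) (hxs : xs ∈ X)
    (hsol : ∀ φ : ℝ → V, (∀ t, 0 ≤ t → φ t ∈ X ∧
      HasDerivWithinAt φ (F (φ t) - φ t) (Set.Ici 0) t) → Tendsto φ atTop (𝓝 xs))
    {g : V → ℝ} (hg : ContinuousOn g X) :
    Tendsto (fun T => (∑ t ∈ Finset.range T, α t * g (x t)) / clock α T) atTop (𝓝 (g xs)) := by
  have hc : ContinuousOn (fun p => |g p - g xs|) X := (hg.sub continuousOn_const).abs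
  obtain ⟨M, hM⟩ := hX.exists_bound_of_continuousOn hc
  have hzero := tendsto_clock_div_of_forall_exists_stretch (c := fun t => |g (x t) - g xs|)
    hα.nonneg hα.tendsto_clock (fun t => abs_nonneg _)
    (fun t => (Real.le_norm_self _).trans (hM _ (hxX t)))
    fun ε hε => exists_stretch hα hX hxX hzX hx hF hxs hsol hc (by simp) hε
  rw [tendsto_iff_norm_sub_tendsto_zero]
  refine squeeze_zero' (Eventually.of_forall fun T => norm_nonneg _) ?_ hzero
  filter_upwards [hα.tendsto_clock.eventually_gt_atTop 0] with T hT
  have hdiff : (∑ t ∈ Finset.range T, α t * g (x t)) / clock α T - g xs =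
      (∑ t ∈ Finset.range T, α t * (g (x t) - g xs)) / clock α T := by
    rw [eq_div_iff hT.ne', sub_mul, div_mul_cancel₀ _ hT.ne', clock, Finset.mul_sum,
      ← Finset.sum_sub_distrib]
    exact Finset.sum_congr rfl fun t _ => by ring
  rw [hdiff, norm_div, Real.norm_of_nonneg hT.le]
  refine div_le_div_of_nonneg_right (norm_sum_le_of_le _ fun t _ => ?_) hT.le
  rw [norm_mul, Real.norm_of_nonneg (hα.nonneg t)]
  rfl

end TimeAverages

section Martingales

variable {Ω : Type*} {m0 : MeasurableSpace Ω} {P : Measure Ω} [IsFiniteMeasure P]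
  {ℱ : Filtration ℕ m0}

/-- Subtracting the perturbation `c` leaves a supermartingale bounded in `L¹`, so the martingale
convergence theorem applies. -/
theorem ae_exists_tendsto_of_condExp_le_add {Q : ℕ → Ω → ℝ} {c : ℕ → ℝ}
    (hQm : ∀ t, StronglyMeasurable[ℱ t] (Q t)) (hQi : ∀ t, Integrable (Q t) P)
    (hQ0 : ∀ t ω, 0 ≤ Q t ω) (hc : Summable c)
    (hQ : ∀ t, P[Q (t + 1) | ℱ t] ≤ᵐ[P] fun ω => Q t ω + c t) :
    ∀ᵐ ω ∂P, ∃ q, Tendsto (fun t => Q t ω) atTop (𝓝 q) := by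
  have hclock : Tendsto (clock c) atTop (𝓝 (∑' t, c t)) := hc.hasSum.tendsto_sum_nat
  obtain ⟨S, hS⟩ := hclock.norm.bddAbove_range
  have hMi : ∀ t, Integrable (fun ω => clock c t - Q t ω) P := fun t =>
    (integrable_const _).sub (hQi t)
  have hM : Submartingale (fun t ω => clock c t - Q t ω) ℱ P := by
    refine submartingale_nat (fun t => stronglyMeasurable_const.sub (hQm t)) hMi fun t => ?_
    filter_upwards [hQ t, condExp_sub (integrable_const (clock c (t + 1))) (hQi (t + 1)) (ℱ t)]
      with ω hle hsub
    refine le_of_le_of_eq ?_ hsub.symm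
    rw [Pi.sub_apply, condExp_const (ℱ.le t), clock_succ]
    linarith
  have hL1 : ∀ t, eLpNorm (fun ω => clock c t - Q t ω) 1 P ≤
      ((∫ _, 2 * S ∂P - ∫ ω, (clock c 0 - Q 0 ω) ∂P).toNNReal : ENNReal) := fun t => by
    rw [eLpNorm_one_eq_lintegral_enorm, ← ofReal_integral_norm_eq_lintegral_enorm (hMi t)]
    refine ENNReal.ofReal_le_ofReal ?_
    have hmono : ∫ ω, (clock c 0 - Q 0 ω) ∂P ≤ ∫ ω, (clock c t - Q t ω) ∂P := by
      simpa using hM.setIntegral_le t.zero_le MeasurableSet.univ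
    refine le_trans ?_ (sub_le_sub_left hmono _)
    rw [← integral_sub (integrable_const _) (hMi t)]
    refine integral_mono (hMi t).norm ((integrable_const _).sub (hMi t)) fun ω => ?_
    have hSt := abs_le.1 (hS ⟨t, rfl⟩ : |clock c t| ≤ S)
    exact abs_le.2 ⟨by linarith [hQ0 t ω], by linarith [hQ0 t ω]⟩
  filter_upwards [hM.exists_ae_tendsto_of_bdd hL1] with ω ⟨q, hq⟩
  exact ⟨∑' t, c t - q, by simpa using hclock.sub hq⟩

omit [IsFiniteMeasure P] in
theorem condExp_sum_mul_eq_zero {ι : Type*} [Fintype ι] {m : MeasurableSpace Ω}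
    {n ξ : ι → Ω → ℝ} (hn : ∀ i, StronglyMeasurable[m] (n i))
    (hξ : ∀ i, Integrable (ξ i) P) (hnξ : ∀ i, Integrable (n i * ξ i) P)
    (h : ∀ i, P[ξ i | m] =ᵐ[P] 0) : P[∑ i, n i * ξ i | m] =ᵐ[P] 0 := by
  have hzero : ∀ i, P[n i * ξ i | m] =ᵐ[P] 0 := fun i => by
    filter_upwards [condExp_mul_of_stronglyMeasurable_left (hn i) (hnξ i) (hξ i), h i]
      with ω hmul hi
    rw [hmul, Pi.mul_apply, hi, Pi.zero_apply, mul_zero]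
  filter_upwards [condExp_finsetSum (s := Finset.univ) (fun i _ => hnξ i) m, ae_all_iff.2 hzero]
    with ω hsum hω
  rw [hsum, Finset.sum_apply]
  exact Finset.sum_eq_zero fun i _ => hω i

variable {ι : Type*} [Fintype ι] {W : Matrix ι ι ℝ} {α : ℕ → ℝ}

theorem sum_sq_diffuse_succ_le [DecidableEq ι] (hW : W ∈ doublyStochastic ℝ ι)
    (r : ℕ → ι → ℝ) (t : ℕ) :
    ∑ i, diffuse W α r (t + 1) i ^ 2 ≤ ∑ i, diffuse W α r t i ^ 2 +
      2 * α t * ∑ i, diffuse W α r t i * r t i + α t ^ 2 * ∑ i, r t i ^ 2 := by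
  refine (sum_sq_mulVec_le_of_mem_doublyStochastic hW _).trans_eq ?_
  simp only [Pi.add_apply, Pi.smul_apply, smul_eq_mul, Finset.mul_sum,
    ← Finset.sum_add_distrib]
  exact Finset.sum_congr rfl fun i _ => by ring

theorem measurable_diffuse (W : Matrix ι ι ℝ) (α : ℕ → ℝ) {ξ : ℕ → Ω → ι → ℝ}
    (hξ : ∀ t, Measurable[ℱ (t + 1)] (ξ t)) (t : ℕ) :
    Measurable[ℱ t] fun ω => diffuse W α (fun s => ξ s ω) t := by
  induction t with
  | zero => exact measurable_const
  | succ t ih =>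
    exact (Continuous.matrix_mulVec continuous_const continuous_id).measurable.comp
      ((ih.mono (ℱ.mono (Nat.le_succ t)) le_rfl).add ((hξ t).const_smul (α t)))

variable [DecidableEq ι]

theorem exists_forall_norm_diffuse_apply_le (hW : W ∈ doublyStochastic ℝ ι) (α : ℕ → ℝ)
    {ξ : ℕ → Ω → ι → ℝ} {K : ℝ} (hK : ∀ t ω, ‖ξ t ω‖ ≤ K) (t : ℕ) :
    ∃ C, ∀ ω i, ‖diffuse W α (fun s => ξ s ω) t i‖ ≤ C := by
  refine ⟨∑ s ∈ Finset.range t, ‖α s‖ * K, fun ω i => (norm_le_pi_norm _ i).trans <|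
    (norm_diffuse_le (mem_doublyStochastic_iff_mem_rowStochastic_and_mem_colStochastic.1 hW).1
      α _ t).trans (Finset.sum_le_sum fun s _ => ?_)⟩
  rw [norm_smul]
  exact mul_le_mul_of_nonneg_left (hK s ω) (norm_nonneg _)

theorem integrable_sum_sq_diffuse (hW : W ∈ doublyStochastic ℝ ι) (α : ℕ → ℝ)
    {ξ : ℕ → Ω → ι → ℝ} {K : ℝ} (hK : ∀ t ω, ‖ξ t ω‖ ≤ K)
    (hm : ∀ t, Measurable[ℱ (t + 1)] (ξ t)) (t : ℕ) :
    Integrable (fun ω => ∑ i, diffuse W α (fun s => ξ s ω) t i ^ 2) P := by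
  obtain ⟨C, hC⟩ := exists_forall_norm_diffuse_apply_le hW α hK t
  refine integrable_finsetSum _ fun i _ => Integrable.of_bound (C := C ^ 2)
    (((measurable_pi_apply i).comp ((measurable_diffuse W α hm t).mono (ℱ.le t) le_rfl)).pow_const
      2).aestronglyMeasurable (Eventually.of_forall fun ω => ?_)
  rw [norm_pow]
  exact pow_le_pow_left₀ (norm_nonneg _) (hC ω i) 2

theorem condExp_sum_sq_diffuse_succ_le (hW : W ∈ doublyStochastic ℝ ι) (α : ℕ → ℝ)
    {ξ : ℕ → Ω → ι → ℝ} {K : ℝ} (hK : ∀ t ω, ‖ξ t ω‖ ≤ K)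
    (hm : ∀ t, Measurable[ℱ (t + 1)] (ξ t))
    (hξ : ∀ t i, P[fun ω => ξ t ω i | ℱ t] =ᵐ[P] 0) (t : ℕ) :
    P[fun ω => ∑ i, diffuse W α (fun s => ξ s ω) (t + 1) i ^ 2 | ℱ t] ≤ᵐ[P] fun ω =>
      ∑ i, diffuse W α (fun s => ξ s ω) t i ^ 2 + α t ^ 2 * (Fintype.card ι * K ^ 2) := by
  set n : ι → Ω → ℝ := fun i ω => diffuse W α (fun s => ξ s ω) t i
  set Q : ℕ → Ω → ℝ := fun t ω => ∑ i, diffuse W α (fun s => ξ s ω) t i ^ 2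
  set D : Ω → ℝ := ∑ i, n i * fun ω => ξ t ω i
  have hnm : ∀ i, Measurable[ℱ t] (n i) := fun i =>
    (measurable_pi_apply i).comp (measurable_diffuse W α hm t)
  have hξK : ∀ ω i, ‖ξ t ω i‖ ≤ K := fun ω i => (norm_le_pi_norm _ i).trans (hK t ω)
  have hξi : ∀ i, Integrable (fun ω => ξ t ω i) P := fun i =>
    Integrable.of_bound (((measurable_pi_apply i).comp (hm t)).mono
      (ℱ.le _) le_rfl).aestronglyMeasurable K (Eventually.of_forall fun ω => hξK ω i)
  obtain ⟨C, hC⟩ := exists_forall_norm_diffuse_apply_le hW α hK t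
  have hnξ : ∀ i, Integrable (n i * fun ω => ξ t ω i) P := fun i =>
    (hξi i).bdd_mul ((hnm i).mono (ℱ.le t) le_rfl).aestronglyMeasurable
      (Eventually.of_forall fun ω => hC ω i)
  have hQi : ∀ t, Integrable (Q t) P := integrable_sum_sq_diffuse hW α hK hm
  have hRi : Integrable (fun ω => Q t ω + α t ^ 2 * (Fintype.card ι * K ^ 2)) P :=
    (hQi t).add (integrable_const _)
  have hRm : StronglyMeasurable[ℱ t] fun ω => Q t ω + α t ^ 2 * (Fintype.card ι * K ^ 2) :=
    ((Finset.measurable_sum _ fun i _ => (hnm i).pow_const 2).add_const _).stronglyMeasurable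
  have hDi : Integrable ((2 * α t) • D) P := (integrable_finsetSum' _ fun i _ => hnξ i).smul _
  have hstep : ∀ ω, Q (t + 1) ω ≤
      Q t ω + α t ^ 2 * (Fintype.card ι * K ^ 2) + (2 * α t) * D ω := fun ω => by
    have hsq : ∑ i, ξ t ω i ^ 2 ≤ Fintype.card ι * K ^ 2 := by
      rw [← nsmul_eq_mul, ← Finset.card_univ]
      exact Finset.sum_le_card_nsmul _ _ _ fun i _ => sq_le_sq.2 ((hξK ω i).trans (le_abs_self K))
    have hsucc := sum_sq_diffuse_succ_le hW (α := α) (fun s => ξ s ω) t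
    have hD : D ω = ∑ i, n i ω * ξ t ω i := by simp [D]
    rw [hD]
    linarith [mul_le_mul_of_nonneg_left hsq (sq_nonneg (α t))]
  filter_upwards [condExp_mono (m := ℱ t) (hQi (t + 1)) (hRi.add hDi) (Eventually.of_forall hstep),
    condExp_add hRi hDi (ℱ t), condExp_smul (μ := P) (2 * α t) D (ℱ t),
    condExp_sum_mul_eq_zero (fun i => (hnm i).stronglyMeasurable) hξi hnξ (hξ t)]
    with ω hle hadd hsmul hzero
  rwa [hadd, Pi.add_apply, condExp_of_stronglyMeasurable (ℱ.le t) hRm hRi, hsmul, Pi.smul_apply,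
    hzero, Pi.zero_apply, smul_zero, add_zero] at hle

theorem ae_exists_norm_diffuse_le (hW : W ∈ doublyStochastic ℝ ι) (hα : Summable fun t => α t ^ 2)
    {ξ : ℕ → Ω → ι → ℝ} {K : ℝ} (hK : ∀ t ω, ‖ξ t ω‖ ≤ K)
    (hm : ∀ t, Measurable[ℱ (t + 1)] (ξ t))
    (hξ : ∀ t i, P[fun ω => ξ t ω i | ℱ t] =ᵐ[P] 0) :
    ∀ᵐ ω ∂P, ∃ B, ∀ t, ‖diffuse W α (fun s => ξ s ω) t‖ ≤ B := by
  have hconv := ae_exists_tendsto_of_condExp_le_add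
    (fun t => (Finset.measurable_sum _ fun i _ => ((measurable_pi_apply i).comp
      (measurable_diffuse W α hm t)).pow_const 2).stronglyMeasurable)
    (integrable_sum_sq_diffuse hW α hK hm)
    (fun t ω => Finset.sum_nonneg fun i _ => sq_nonneg _) (hα.mul_right _)
    (condExp_sum_sq_diffuse_succ_le hW α hK hm hξ)
  filter_upwards [hconv] with ω ⟨q, hq⟩
  obtain ⟨B, hB⟩ := hq.bddAbove_range
  refine ⟨√B, fun t => (pi_norm_le_iff_of_nonneg (Real.sqrt_nonneg B)).2 fun i => ?_⟩
  exact Real.abs_le_sqrt ((Finset.single_le_sum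
    (f := fun i => diffuse W α (fun s => ξ s ω) t i ^ 2) (fun i _ => sq_nonneg _)
    (Finset.mem_univ i)).trans (hB ⟨t, rfl⟩))

end Martingales

section Densities

variable {E : Type*} [MeasurableSpace E] {ν : Measure E}

/-- Scheffé's lemma. As `f p` and `g` have the same integral, the distance in mean is twice the
integral of `(g - f p)⁺`, which is dominated by `g`. -/
theorem tendsto_integral_norm_sub_of_integral_eq {β : Type*} {l : Filter β}
    [l.IsCountablyGenerated] {f : β → E → ℝ} {g : E → ℝ} (hf : ∀ᶠ p in l, Integrable (f p) ν)
    (hg : Integrable g ν) (hf0 : ∀ᶠ p in l, ∀ y, 0 ≤ f p y) (hg0 : ∀ y, 0 ≤ g y)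
    (hfg : ∀ᶠ p in l, ∫ y, f p y ∂ν = ∫ y, g y ∂ν)
    (hlim : ∀ y, Tendsto (fun p => f p y) l (𝓝 (g y))) :
    Tendsto (fun p => ∫ y, ‖f p y - g y‖ ∂ν) l (𝓝 0) := by
  have hpos : Tendsto (fun p => 2 * ∫ y, max (g y - f p y) 0 ∂ν) l (𝓝 0) := by
    have hdom := tendsto_integral_filter_of_dominated_convergence (μ := ν) (l := l)
      (F := fun p y => max (g y - f p y) 0) (f := fun _ => 0) g
      (hf.mono fun p hp => (hg.sub hp).pos_part.aestronglyMeasurable) ?_ hg ?_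
    · simpa using hdom.const_mul 2
    · filter_upwards [hf0] with p hp
      refine Eventually.of_forall fun y => ?_
      rw [Real.norm_of_nonneg (le_max_right _ _)]
      exact max_le (sub_le_self _ (hp y)) (hg0 y)
    · exact Eventually.of_forall fun y => by
        simpa using ((hlim y).const_sub (g y)).max (tendsto_const_nhds (x := 0))
  refine hpos.congr' ?_
  filter_upwards [hf, hfg] with p hp heq
  have hsplit : ∀ y, ‖f p y - g y‖ = f p y - g y + 2 * max (g y - f p y) 0 := fun y => by
    rcases le_total (g y) (f p y) with h | h
    · rw [Real.norm_of_nonneg (sub_nonneg.2 h), max_eq_right (sub_nonpos.2 h)]; ring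
    · rw [Real.norm_of_nonpos (sub_nonpos.2 h), max_eq_left (sub_nonneg.2 h)]; ring
  have hsub : Integrable (fun y => f p y - g y) ν := hp.sub hg
  have hmax : Integrable (fun y => max (g y - f p y) 0) ν := (hg.sub hp).pos_part
  simp only [hsplit]
  rw [integral_add hsub (hmax.const_mul 2), integral_sub hp hg, heq, sub_self, zero_add,
    integral_const_mul]

theorem tendsto_integral_mul_of_tendsto_integral_norm_sub {β : Type*} {l : Filter β}
    [l.IsCountablyGenerated] {f h : β → E → ℝ} {g k : E → ℝ} {L : ℝ}
    (hf : ∀ᶠ p in l, Integrable (f p) ν) (hg : Integrable g ν)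
    (hfg : Tendsto (fun p => ∫ y, ‖f p y - g y‖ ∂ν) l (𝓝 0))
    (hh : ∀ᶠ p in l, AEStronglyMeasurable (h p) ν) (hL : ∀ᶠ p in l, ∀ y, ‖h p y‖ ≤ L)
    (hlim : ∀ y, g y ≠ 0 → Tendsto (fun p => h p y) l (𝓝 (k y))) :
    Tendsto (fun p => ∫ y, f p y * h p y ∂ν) l (𝓝 (∫ y, g y * k y ∂ν)) := by
  have hfixed : Tendsto (fun p => ∫ y, g y * h p y ∂ν) l (𝓝 (∫ y, g y * k y ∂ν)) := by
    refine tendsto_integral_filter_of_dominated_convergence (fun y => ‖g y‖ * L)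
      (hh.mono fun p hp => hg.aestronglyMeasurable.mul hp) ?_ (hg.norm.mul_const L)
      (Eventually.of_forall fun y => ?_)
    · filter_upwards [hL] with p hp
      exact Eventually.of_forall fun y => (norm_mul _ _).trans_le
        (mul_le_mul_of_nonneg_left (hp y) (norm_nonneg _))
    · rcases eq_or_ne (g y) 0 with h0 | h0
      · simpa [h0] using tendsto_const_nhds
      · exact (hlim y h0).const_mul _
  have hrest : Tendsto (fun p => ∫ y, (f p y - g y) * h p y ∂ν) l (𝓝 0) := by
    refine squeeze_zero_norm' ?_ (by simpa using hfg.mul_const L)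
    filter_upwards [hf, hL] with p hp hpL
    rw [← integral_mul_const]
    exact norm_integral_le_of_norm_le ((hp.sub hg).norm.mul_const L) (Eventually.of_forall
      fun y => (norm_mul _ _).trans_le (mul_le_mul_of_nonneg_left (hpL y) (norm_nonneg _)))
  rw [← add_zero (∫ y, g y * k y ∂ν)]
  refine (hfixed.add hrest).congr' ?_
  filter_upwards [hf, hh, hL] with p hp hph hpL
  have hint : ∀ {u : E → ℝ}, Integrable u ν → Integrable (fun y => u y * h p y) ν := fun hu =>
    hu.mul_bdd hph (Eventually.of_forall hpL)
  have hsub : Integrable (fun y => f p y - g y) ν := hp.sub hg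
  rw [← integral_add (hint hg) (hint hsub)]
  exact integral_congr_ae (Eventually.of_forall fun y => by ring)

variable {f g : E → ℝ}

theorem withDensity_eq_withDensity_div (hf : Measurable f) (hg : Measurable g) (hg0 : ∀ y, 0 ≤ g y)
    (hfg : ∀ y, g y = 0 → f y = 0) :
    ν.withDensity (fun y => ENNReal.ofReal (f y)) =
      (ν.withDensity fun y => ENNReal.ofReal (g y)).withDensity
        fun y => ENNReal.ofReal (f y / g y) := by
  have hdiv : Measurable fun y => f y / g y := hf.div hg
  rw [← withDensity_mul _ hg.ennreal_ofReal hdiv.ennreal_ofReal]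
  congr 1
  ext y
  rw [Pi.mul_apply, ← ENNReal.ofReal_mul (hg0 y), mul_div_cancel_of_imp' (hfg y)]

theorem llr_withDensity_ae_eq [SigmaFinite (ν.withDensity fun y => ENNReal.ofReal (g y))]
    (hf : Measurable f) (hf0 : ∀ y, 0 ≤ f y) (hg : Measurable g) (hg0 : ∀ y, 0 ≤ g y)
    (hfg : ∀ y, g y = 0 → f y = 0) :
    llr (ν.withDensity fun y => ENNReal.ofReal (f y))
        (ν.withDensity fun y => ENNReal.ofReal (g y))
      =ᵐ[ν.withDensity fun y => ENNReal.ofReal (f y)] fun y => Real.log (f y / g y) := by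
  have hdiv : Measurable fun y => f y / g y := hf.div hg
  rw [withDensity_eq_withDensity_div hf hg hg0 hfg]
  filter_upwards [(withDensity_absolutelyContinuous _ _).ae_le
    (Measure.rnDeriv_withDensity _ hdiv.ennreal_ofReal)] with y hy
  rw [llr, hy, ENNReal.toReal_ofReal (div_nonneg (hf0 y) (hg0 y))]

theorem klDiv_withDensity_ne_top [SigmaFinite (ν.withDensity fun y => ENNReal.ofReal (g y))]
    [IsFiniteMeasure (ν.withDensity fun y => ENNReal.ofReal (f y))]
    (hf : Measurable f) (hf0 : ∀ y, 0 ≤ f y) (hg : Measurable g) (hg0 : ∀ y, 0 ≤ g y)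
    (hfg : ∀ y, g y = 0 → f y = 0) {L : ℝ} (hL : ∀ y, |Real.log (f y / g y)| ≤ L) :
    InformationTheory.klDiv (ν.withDensity fun y => ENNReal.ofReal (f y))
      (ν.withDensity fun y => ENNReal.ofReal (g y)) ≠ ⊤ := by
  refine InformationTheory.klDiv_ne_top ?_ ?_
  · rw [withDensity_eq_withDensity_div hf hg hg0 hfg]
    exact withDensity_absolutelyContinuous _ _
  · exact (Integrable.of_bound (hf.div hg).log.aestronglyMeasurable L
      (Eventually.of_forall hL)).congr (llr_withDensity_ae_eq hf hf0 hg hg0 hfg).symm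

theorem toReal_klDiv_withDensity [IsFiniteMeasure (ν.withDensity fun y => ENNReal.ofReal (g y))]
    [IsFiniteMeasure (ν.withDensity fun y => ENNReal.ofReal (f y))]
    (hf : Measurable f) (hf0 : ∀ y, 0 ≤ f y) (hg : Measurable g) (hg0 : ∀ y, 0 ≤ g y)
    (hfg : ∀ y, g y = 0 → f y = 0)
    (huniv : ν.withDensity (fun y => ENNReal.ofReal (f y)) Set.univ =
      ν.withDensity (fun y => ENNReal.ofReal (g y)) Set.univ) :
    (InformationTheory.klDiv (ν.withDensity fun y => ENNReal.ofReal (f y))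
      (ν.withDensity fun y => ENNReal.ofReal (g y))).toReal =
    ∫ y, Real.log (f y / g y) ∂(ν.withDensity fun y => ENNReal.ofReal (f y)) := by
  rw [InformationTheory.toReal_klDiv_of_measure_eq ?_ huniv,
    integral_congr_ae (llr_withDensity_ae_eq hf hf0 hg hg0 hfg)]
  rw [withDensity_eq_withDensity_div hf hg hg0 hfg]
  exact withDensity_absolutelyContinuous _ _

theorem integral_withDensity_ofReal (hf : Measurable f) (hf0 : ∀ y, 0 ≤ f y) (h : E → ℝ) :
    ∫ y, h y ∂(ν.withDensity fun y => ENNReal.ofReal (f y)) = ∫ y, f y * h y ∂ν := by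
  rw [integral_withDensity_eq_integral_toReal_smul hf.ennreal_ofReal (by simp)]
  simp only [ENNReal.toReal_ofReal (hf0 _), smul_eq_mul]

end Densities

section ConditionalLaw

variable {Ω X Y F : Type*} {m m0 : MeasurableSpace Ω} [MeasurableSpace X] [MeasurableSpace Y]
  [NormedAddCommGroup F] {P : Measure Ω} [IsFiniteMeasure P] {ξ : Ω → X} {η : Ω → Y}
  {κ : Kernel X Y} [IsMarkovKernel κ]

theorem measure_inter_preimage_eq_setLIntegral (hm : m ≤ m0) (hη : Measurable η) {A : Set Ω}
    (hA : MeasurableSet[m] A) {B : Set Y} (hB : MeasurableSet B)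
    (hκ : P[(η ⁻¹' B).indicator (fun _ => (1 : ℝ)) | m] =ᵐ[P] fun ω => (κ (ξ ω)).real B) :
    P (A ∩ η ⁻¹' B) = ∫⁻ ω in A, κ (ξ ω) B ∂P := by
  have hreal : P.real (A ∩ η ⁻¹' B) = ∫ ω in A, (κ (ξ ω)).real B ∂P := by
    rw [← setIntegral_congr_ae (hm _ hA) (hκ.mono fun ω hω _ => hω),
      setIntegral_condExp hm ((integrable_const _).indicator (hη hB)) hA,
      setIntegral_indicator (hη hB), setIntegral_const, smul_eq_mul, mul_one]
  rw [← ofReal_measureReal, hreal, ofReal_integral_eq_lintegral_ofReal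
    (integrable_condExp.congr hκ).integrableOn (Eventually.of_forall fun _ => measureReal_nonneg)]
  exact lintegral_congr fun _ => ofReal_measureReal

theorem map_restrict_prodMk_eq_compProd (hm : m ≤ m0) (hξ : Measurable[m] ξ) (hη : Measurable η)
    (hκ : ∀ B, MeasurableSet B →
      P[(η ⁻¹' B).indicator (fun _ => (1 : ℝ)) | m] =ᵐ[P] fun ω => (κ (ξ ω)).real B)
    {A : Set Ω} (hA : MeasurableSet[m] A) :
    (P.restrict A).map (fun ω => (ξ ω, η ω)) = (P.restrict A).map ξ ⊗ₘ κ := by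
  have hξ' : Measurable ξ := hξ.mono hm le_rfl
  refine Measure.ext_prod fun {C B} hC hB => ?_
  rw [Measure.map_apply (hξ'.prodMk hη) (hC.prod hB), Measure.compProd_apply_prod hC hB,
    setLIntegral_map hC (κ.measurable_coe hB) hξ', Measure.restrict_restrict (hξ' hC),
    ← measure_inter_preimage_eq_setLIntegral hm hη ((hξ hC).inter hA) hB (hκ B hB),
    Measure.restrict_apply ((hξ'.prodMk hη) (hC.prod hB)), Set.mk_preimage_prod,
    Set.inter_right_comm]

theorem ae_mem_of_forall_ae_mem (hm : m ≤ m0) (hξ : Measurable[m] ξ) (hη : Measurable η)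
    (hκ : ∀ B, MeasurableSet B →
      P[(η ⁻¹' B).indicator (fun _ => (1 : ℝ)) | m] =ᵐ[P] fun ω => (κ (ξ ω)).real B)
    {S : Set (X × Y)} (hS : MeasurableSet S) (h : ∀ p, ∀ᵐ v ∂(κ p), (p, v) ∈ S) :
    ∀ᵐ ω ∂P, (ξ ω, η ω) ∈ S := by
  have hmap := map_restrict_prodMk_eq_compProd hm hξ hη hκ (@MeasurableSet.univ _ m)
  rw [Measure.restrict_univ] at hmap
  refine (ae_map_iff (p := (· ∈ S)) ((hξ.mono hm le_rfl).prodMk hη).aemeasurable hS).1 ?_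
  rw [hmap]
  exact (Measure.ae_compProd_iff hS).2 (Eventually.of_forall h)

theorem condExp_ae_eq_integral_kernel [NormedSpace ℝ F] [CompleteSpace F] (hm : m ≤ m0)
    (hξ : Measurable[m] ξ) (hη : Measurable η)
    (hκ : ∀ B, MeasurableSet B →
      P[(η ⁻¹' B).indicator (fun _ => (1 : ℝ)) | m] =ᵐ[P] fun ω => (κ (ξ ω)).real B)
    {ρ : X × Y → F} (hρ : StronglyMeasurable ρ) (hint : Integrable (fun ω => ρ (ξ ω, η ω)) P) :
    P[fun ω => ρ (ξ ω, η ω) | m] =ᵐ[P] fun ω => ∫ v, ρ (ξ ω, v) ∂(κ (ξ ω)) := by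
  have hξ' : Measurable ξ := hξ.mono hm le_rfl
  have hpair : AEMeasurable (fun ω => (ξ ω, η ω)) P := (hξ'.prodMk hη).aemeasurable
  have hmean : StronglyMeasurable fun p => ∫ v, ρ (p, v) ∂(κ p) := hρ.integral_kernel_prod_right'
  have hρA : ∀ A, MeasurableSet[m] A → Integrable ρ ((P.restrict A).map ξ ⊗ₘ κ) := fun A hA => by
    rw [← map_restrict_prodMk_eq_compProd hm hξ hη hκ hA,
      integrable_map_measure hρ.aestronglyMeasurable hpair.restrict]
    exact hint.integrableOn
  refine (ae_eq_condExp_of_forall_setIntegral_eq hm hint (fun A hA _ => ?_) (fun A hA _ => ?_)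
    (hmean.comp_measurable hξ).aestronglyMeasurable).symm
  · exact (hρA A hA).integral_compProd.comp_measurable hξ'
  · rw [← integral_map hpair.restrict hρ.aestronglyMeasurable,
      map_restrict_prodMk_eq_compProd hm hξ hη hκ hA, Measure.integral_compProd (hρA A hA),
      integral_map hξ'.aemeasurable hmean.aestronglyMeasurable]
    rfl

end ConditionalLaw

namespace Game

section Information

open InformationTheory

variable {ι Θ : Type*} {d : ι → ℕ} {G : Game ι Θ d} {θs θ : Θ} {j : ι} {x : Profile d}

theorem IsModel.isCompact_profiles (hG : G.IsModel) : IsCompact G.profiles := by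
  convert isCompact_univ_pi hG.compact_strat
  ext
  simp only [profiles, Set.mem_ofPred_eq, Set.mem_pi, Set.mem_univ, true_imp_iff]

/-- The log-likelihood ratio of `θs` to `θ` for the realized cost `y` of agent `j`. -/
def logRatio (G : Game ι Θ d) (θs θ : Θ) (j : ι) (x : Profile d) (y : ℝ) : ℝ :=
  Real.log (G.f j y x θs / G.f j y x θ)

/-- The mean under `θs` of the log-likelihood ratio of `θs` to `θ`: the Kullback-Leibler divergence
of the laws of the realized costs of agent `j`, as a real number. -/
def info (G : Game ι Θ d) (θs θ : Θ) (j : ι) (x : Profile d) : ℝ :=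
  ∫ y, G.logRatio θs θ j x y ∂(G.law j x θs)

theorem IsModel.klDiv_law_ne_top (hG : G.IsModel) (h1 : G.BoundedInformation)
    (hx : x ∈ G.profiles) :
    klDiv (G.law j x θs) (G.law j x θ) ≠ ⊤ := by
  have hprob := hG.law_prob j x hx
  simp only [law] at hprob
  obtain ⟨L, -, hL⟩ := h1.bounded
  exact klDiv_withDensity_ne_top (hG.f_measurable j x hx θs) (fun y => hG.f_nonneg j y x hx θs)
    (hG.f_measurable j x hx θ) (fun y => hG.f_nonneg j y x hx θ)
    (fun y => h1.common_support j y x hx θs θ) fun y => hL j θs θ x hx y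

theorem IsModel.toReal_klDiv_law (hG : G.IsModel) (h1 : G.BoundedInformation)
    (hx : x ∈ G.profiles) :
    (klDiv (G.law j x θs) (G.law j x θ)).toReal = G.info θs θ j x := by
  have hprob := hG.law_prob j x hx
  simp only [law] at hprob
  exact toReal_klDiv_withDensity (hG.f_measurable j x hx θs) (fun y => hG.f_nonneg j y x hx θs)
    (hG.f_measurable j x hx θ) (fun y => hG.f_nonneg j y x hx θ)
    (fun y => h1.common_support j y x hx θs θ)
    (measure_univ.trans measure_univ.symm)

theorem IsModel.info_nonneg (hG : G.IsModel) (h1 : G.BoundedInformation) (hx : x ∈ G.profiles) :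
    0 ≤ G.info θs θ j x :=
  ENNReal.toReal_nonneg.trans_eq (hG.toReal_klDiv_law h1 hx)

theorem IsModel.abs_info_le (hG : G.IsModel) (hx : x ∈ G.profiles) {L : ℝ}
    (hL : ∀ y, |G.logRatio θs θ j x y| ≤ L) : |G.info θs θ j x| ≤ L := by
  have := hG.law_prob j x hx θs
  simpa only [info, Real.norm_eq_abs, probReal_univ, mul_one] using
    norm_integral_le_of_norm_le_const (C := L) (f := G.logRatio θs θ j x) (μ := G.law j x θs)
      (Eventually.of_forall hL)

theorem IsModel.integrable_f (hG : G.IsModel) (hx : x ∈ G.profiles) :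
    Integrable (fun y => G.f j y x θ) (G.ref j) := by
  have := hG.law_prob j x hx θ
  refine ⟨(hG.f_measurable j x hx θ).aestronglyMeasurable, ?_⟩
  rw [hasFiniteIntegral_iff_ofReal (Eventually.of_forall fun y => hG.f_nonneg j y x hx θ),
    ← setLIntegral_univ, ← withDensity_apply _ MeasurableSet.univ]
  exact measure_lt_top (G.law j x θ) Set.univ

theorem IsModel.integral_law (hG : G.IsModel) (hx : x ∈ G.profiles) (h : ℝ → ℝ) :
    ∫ y, h y ∂(G.law j x θ) = ∫ y, G.f j y x θ * h y ∂(G.ref j) :=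
  integral_withDensity_ofReal (hG.f_measurable j x hx θ) (fun y => hG.f_nonneg j y x hx θ) h

theorem IsModel.integral_f (hG : G.IsModel) (hx : x ∈ G.profiles) :
    ∫ y, G.f j y x θ ∂(G.ref j) = 1 := by
  have := hG.law_prob j x hx θ
  simpa using (hG.integral_law (j := j) (θ := θ) hx fun _ => 1).symm

theorem IsModel.continuousOn_info [Countable ι] (hG : G.IsModel) (h1 : G.BoundedInformation) :
    ContinuousOn (G.info θs θ j) G.profiles := by
  intro p hp
  obtain ⟨L, -, hL⟩ := h1.bounded
  have hmem : ∀ᶠ q in 𝓝[G.profiles] p, q ∈ G.profiles := eventually_mem_nhdsWithin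
  have hfint : ∀ᶠ q in 𝓝[G.profiles] p, Integrable (fun y => G.f j y q θs) (G.ref j) :=
    hmem.mono fun q hq => hG.integrable_f hq
  have hmean := tendsto_integral_norm_sub_of_integral_eq hfint (hG.integrable_f hp)
    (hmem.mono fun q hq y => hG.f_nonneg j y q hq θs) (fun y => hG.f_nonneg j y p hp θs)
    (hmem.mono fun q hq => (hG.integral_f hq).trans (hG.integral_f hp).symm)
    (fun y => h1.continuous j y θs p hp)
  have hlim := tendsto_integral_mul_of_tendsto_integral_norm_sub (h := G.logRatio θs θ j)
    (k := G.logRatio θs θ j p) hfint (hG.integrable_f hp) hmean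
    (hmem.mono fun q hq => ((hG.f_measurable j q hq θs).div
      (hG.f_measurable j q hq θ)).log.aestronglyMeasurable)
    (hmem.mono fun q hq y => hL j θs θ q hq y) fun y hy => ?_
  · rw [ContinuousWithinAt, info, hG.integral_law hp]
    exact hlim.congr' (hmem.mono fun q hq => (hG.integral_law hq _).symm)
  · have hy' : G.f j y p θ ≠ 0 := fun h0 => hy (h1.common_support j y p hp θs θ h0)
    exact ((h1.continuous j y θs p hp).div (h1.continuous j y θ p hp) hy').log (div_ne_zero hy hy')

theorem IsModel.measurable_info [Countable ι] (hG : G.IsModel) (h1 : G.BoundedInformation) :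
    Measurable (G.profiles.domRestrict (G.info θs θ j)) :=
  (hG.continuousOn_info h1).domRestrict.measurable

theorem IsModel.measurable_uncurry_f [Countable ι] (hG : G.IsModel) (h1 : G.BoundedInformation)
    (j : ι) (θ : Θ) :
    Measurable (Function.uncurry fun (p : G.profiles) (y : ℝ) => G.f j y p θ) :=
  measurable_uncurry_of_continuous_of_measurable
    (fun y => continuousOn_iff_continuous_domRestrict.1 (h1.continuous j y θ))
    fun p => hG.f_measurable j p p.2 θ

theorem IsModel.exists_isMarkovKernel_eq_law [Countable ι] (hG : G.IsModel)
    (h1 : G.BoundedInformation) (j : ι) (θ : Θ) :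
    ∃ κ : Kernel G.profiles ℝ, IsMarkovKernel κ ∧ ∀ p, κ p = G.law j p θ := by
  have := hG.sigmaFinite_ref j
  have hκ : ∀ p, (Kernel.const G.profiles (G.ref j)).withDensity
      (fun p y => ENNReal.ofReal (G.f j y p θ)) p = G.law j p θ := fun p => by
    rw [Kernel.withDensity_apply _ (hG.measurable_uncurry_f h1 j θ).ennreal_ofReal,
      Kernel.const_apply, law]
  exact ⟨_, ⟨fun p => by rw [hκ]; exact hG.law_prob j p p.2 θ⟩, hκ⟩

variable [Fintype ι]

theorem IsModel.networkDivergence_ne_top [Nonempty ι] (hG : G.IsModel) (h1 : G.BoundedInformation)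
    (hx : x ∈ G.profiles) : G.networkDivergence x θs θ ≠ ⊤ :=
  ENNReal.div_ne_top (ENNReal.sum_ne_top.2 fun _ _ => hG.klDiv_law_ne_top h1 hx)
    (by simp only [ne_eq, Nat.cast_eq_zero, Fintype.card_ne_zero, not_false_eq_true])

theorem IsModel.toReal_networkDivergence (hG : G.IsModel) (h1 : G.BoundedInformation)
    (hx : x ∈ G.profiles) : (G.networkDivergence x θs θ).toReal = 𝔼 j, G.info θs θ j x := by
  rw [networkDivergence, ENNReal.toReal_div, ENNReal.toReal_natCast,
    ENNReal.toReal_sum fun _ _ => hG.klDiv_law_ne_top h1 hx, Fintype.expect_eq_sum_div_card]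
  simp only [hG.toReal_klDiv_law h1 hx]

theorem IsModel.continuousOn_average_info (hG : G.IsModel) (h1 : G.BoundedInformation) :
    ContinuousOn (fun p => 𝔼 j, G.info θs θ j p) G.profiles := by
  simp only [Fintype.expect_eq_sum_div_card]
  exact (continuousOn_finsetSum _ fun j _ => hG.continuousOn_info h1).div_const _

theorem Identifiable.average_info_pos (h2 : G.Identifiable θs) (hG : G.IsModel)
    (h1 : G.BoundedInformation) (hθ : θ ≠ θs) (hx : x ∈ G.profiles) :
    0 < 𝔼 j, G.info θs θ j x := by
  obtain ⟨i, hi⟩ := h2 θ hθ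
  refine Finset.expect_pos' (fun j _ => hG.info_nonneg h1 hx) ⟨i, Finset.mem_univ i, ?_⟩
  rw [← hG.toReal_klDiv_law h1 hx]
  exact ENNReal.toReal_pos (hi x hx).ne' (hG.klDiv_law_ne_top h1 hx)

theorem Identifiable.exists_forall_le_average_info (h2 : G.Identifiable θs) (hG : G.IsModel)
    (h1 : G.BoundedInformation) (hθ : θ ≠ θs) :
    ∃ c > 0, ∀ p ∈ G.profiles, c ≤ 𝔼 j, G.info θs θ j p :=
  hG.isCompact_profiles.exists_forall_le' (hG.continuousOn_average_info h1) fun _ hp =>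
    h2.average_info_pos hG h1 hθ hp

theorem Identifiable.toReal_networkDivergence_pos (h2 : G.Identifiable θs) (hG : G.IsModel)
    (h1 : G.BoundedInformation) (hθ : θ ≠ θs) (hx : x ∈ G.profiles) :
    0 < (G.networkDivergence x θs θ).toReal := by
  rw [hG.toReal_networkDivergence h1 hx]
  exact h2.average_info_pos hG h1 hθ hx

end Information

end Game

section Run

variable {ι Θ Ω : Type*} [Fintype ι] [DecidableEq ι] [Fintype Θ] [mΩ : MeasurableSpace Ω]
  {P : Measure Ω} {d : ι → ℕ} {G : Game ι Θ d} {W : Matrix ι ι ℝ} {α : ℕ → ℝ} {θs θ : Θ}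
  {x : ℕ → Ω → Profile d} {y : ℕ → Ω → ι → ℝ}

theorem IsRun.mem_profiles (h : IsRun P G W α θs x y) (hG : G.IsModel) (hα : IsStepSize α)
    (t : ℕ) (ω : Ω) : x t ω ∈ G.profiles := by
  induction t with
  | zero => exact h.init_mem ω
  | succ t ih =>
    intro i
    obtain ⟨z, hz, hx⟩ := h.strategy_update ω t i
    obtain ⟨h0, h1⟩ := hα.mem_Ioo t
    rw [hx]
    exact hG.convex_strat i (ih i) hz.1 (sub_nonneg.2 h1.le) h0.le (sub_add_cancel _ _)

/-- The increasing family of the pasts `history x y t`. -/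
def IsRun.filtration (h : IsRun P G W α θs x y) : Filtration ℕ mΩ where
  seq := history x y
  mono' _ _ hst := sup_le_sup
    (biSup_mono fun _ hk => le_trans (Set.mem_Iic.1 hk) hst)
    (biSup_mono fun _ hk => lt_of_lt_of_le (Set.mem_Iio.1 hk) hst)
  le' _ := sup_le (iSup₂_le fun s _ => (h.measurable_x s).comap_le)
    (iSup₂_le fun s _ => (h.measurable_y s).comap_le)

/-- The profile of period `t` as a random element of the set of profiles: the likelihoods are only
known to be continuous there. -/
def IsRun.profile (h : IsRun P G W α θs x y) (hG : G.IsModel) (hα : IsStepSize α) (t : ℕ)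
    (ω : Ω) : G.profiles := ⟨x t ω, h.mem_profiles hG hα t ω⟩

theorem IsRun.measurable_profile (h : IsRun P G W α θs x y) (hG : G.IsModel)
    (hα : IsStepSize α) (t : ℕ) : Measurable[history x y t] (h.profile hG hα t) := by
  have hx : Measurable[history x y t] (x t) := Measurable.of_comap_le
    ((le_iSup₂_of_le (f := fun s (_ : s ∈ Set.Iic t) => MeasurableSpace.comap (x s) inferInstance)
      t Set.self_mem_Iic le_rfl).trans le_sup_left)
  exact hx.subtype_mk

omit [DecidableEq ι] [Fintype ι] mΩ in
theorem measurable_cost_history (t : ℕ) : Measurable[history x y (t + 1)] (y t) :=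
  Measurable.of_comap_le ((le_iSup₂_of_le (f := fun s (_ : s ∈ Set.Iio (t + 1)) =>
    MeasurableSpace.comap (y s) inferInstance) t (Nat.lt_succ_self t) le_rfl).trans le_sup_right)

theorem IsRun.condExp_indicator_cost (h : IsRun P G W α θs x y) (hG : G.IsModel)
    (hα : IsStepSize α) (t : ℕ) (j : ι) {B : Set ℝ} (hB : MeasurableSet B) :
    P[((fun ω => y t ω j) ⁻¹' B).indicator (fun _ => (1 : ℝ)) | history x y t] =ᵐ[P]
      fun ω => (G.law j (x t ω) θs).real B := by
  have hlaw := h.cond_law t (Function.update (fun _ => Set.univ) j B) fun i => by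
    rcases eq_or_ne i j with rfl | hij
    · simpa using hB
    · simp [hij]
  have hset : {ω | ∀ i, y t ω i ∈ Function.update (fun _ => Set.univ) j B i} =
      (fun ω => y t ω j) ⁻¹' B := by
    ext ω
    refine ⟨fun hω => by simpa using hω j, fun hω i => ?_⟩
    rcases eq_or_ne i j with rfl | hij
    · simpa using hω
    · simp [hij]
  rw [hset] at hlaw
  refine hlaw.trans (Eventually.of_forall fun ω => ?_)
  have hprob := fun i => hG.law_prob i _ (h.mem_profiles hG hα t ω) θs
  refine (Finset.prod_eq_single_of_mem j (Finset.mem_univ j) fun i _ hij => ?_).trans ?_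
  · simp [hij]
  · simp

theorem IsRun.measurable_info (h : IsRun P G W α θs x y) (hG : G.IsModel) (hα : IsStepSize α)
    (h1 : G.BoundedInformation) (t : ℕ) (j : ι) :
    Measurable[history x y t] fun ω => G.info θs θ j (x t ω) := by
  have hinfo := (hG.measurable_info (θs := θs) (θ := θ) (j := j) h1).comp
    (h.measurable_profile hG hα t)
  exact hinfo

theorem IsRun.measurable_logRatio (h : IsRun P G W α θs x y) (hG : G.IsModel) (hα : IsStepSize α)
    (h1 : G.BoundedInformation) (t : ℕ) (j : ι) :
    Measurable[history x y (t + 1)] fun ω => G.logRatio θs θ j (x t ω) (y t ω j) :=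
  ((hG.measurable_uncurry_f h1 j θs).div (hG.measurable_uncurry_f h1 j θ)).log.comp
    (((h.measurable_profile hG hα t).mono (h.filtration.mono t.le_succ) le_rfl).prodMk
      ((measurable_pi_apply j).comp (measurable_cost_history t)))

variable [IsProbabilityMeasure P]

theorem IsRun.ae_forall_f_pos (h : IsRun P G W α θs x y) (hG : G.IsModel)
    (hα : IsStepSize α) (h1 : G.BoundedInformation) :
    ∀ᵐ ω ∂P, ∀ t j θ, 0 < G.f j (y t ω j) (x t ω) θ := by
  have hne : ∀ t j, ∀ᵐ ω ∂P, G.f j (y t ω j) (x t ω) θs ≠ 0 := fun t j => by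
    obtain ⟨κ, hκm, hκ⟩ := hG.exists_isMarkovKernel_eq_law h1 j θs
    refine ae_mem_of_forall_ae_mem (κ := κ) (h.filtration.le t) (h.measurable_profile hG hα t)
      ((measurable_pi_apply j).comp (h.measurable_y t)) (fun B hB => ?_)
      (hG.measurable_uncurry_f h1 j θs (measurableSet_singleton 0).compl) fun p => ?_
    · simp only [hκ]
      exact h.condExp_indicator_cost hG hα t j hB
    · rw [hκ, Game.law, ae_withDensity_iff (hG.f_measurable j p p.2 θs).ennreal_ofReal]
      refine Eventually.of_forall fun v hv hv0 => hv ?_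
      rw [show G.f j v p θs = 0 from hv0, ENNReal.ofReal_zero]
  filter_upwards [ae_all_iff.2 fun t => ae_all_iff.2 (hne t)] with ω hω t j θ
  have hx := h.mem_profiles hG hα t ω
  exact (hG.f_nonneg j _ _ hx θ).lt_of_ne' fun h0 =>
    hω t j (h1.common_support j _ _ hx θs θ h0)

theorem IsRun.condExp_logRatio (h : IsRun P G W α θs x y) (hG : G.IsModel) (hα : IsStepSize α)
    (h1 : G.BoundedInformation) (t : ℕ) (j : ι) :
    P[fun ω => G.logRatio θs θ j (x t ω) (y t ω j) | history x y t] =ᵐ[P]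
      fun ω => G.info θs θ j (x t ω) := by
  obtain ⟨L, -, hL⟩ := h1.bounded
  obtain ⟨κ, hκm, hκ⟩ := hG.exists_isMarkovKernel_eq_law h1 j θs
  refine (condExp_ae_eq_integral_kernel (κ := κ) (ξ := h.profile hG hα t)
    (η := fun ω => y t ω j) (ρ := fun q => G.logRatio θs θ j q.1 q.2) (h.filtration.le t)
    (h.measurable_profile hG hα t) ((measurable_pi_apply j).comp (h.measurable_y t))
    (fun B hB => ?_) ?_ ?_).trans (Eventually.of_forall fun ω => ?_)
  · simp only [hκ]
    exact h.condExp_indicator_cost hG hα t j hB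
  · exact ((hG.measurable_uncurry_f h1 j θs).div
      (hG.measurable_uncurry_f h1 j θ)).log.stronglyMeasurable
  · exact Integrable.of_bound ((h.measurable_logRatio hG hα h1 t j).mono
      (h.filtration.le (t + 1)) le_rfl).aestronglyMeasurable L
      (Eventually.of_forall fun ω => hL j θs θ _ (h.mem_profiles hG hα t ω) _)
  · simp only [hκ]
    rfl

/-- The noise of the signals about `θs` against `θ` in period `t`: the deviations of the
log-likelihood ratios from their conditional means. -/
def signalNoise (G : Game ι Θ d) (θs θ : Θ) (x : ℕ → Profile d) (y : ℕ → ι → ℝ) (t : ℕ) (j : ι) :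
    ℝ :=
  G.logRatio θs θ j (x t) (y t j) - G.info θs θ j (x t)

theorem IsRun.ae_exists_norm_diffuse_signalNoise_le (h : IsRun P G W α θs x y) (hG : G.IsModel)
    (hα : IsStepSize α) (h1 : G.BoundedInformation) (hW : W ∈ doublyStochastic ℝ ι) (θ : Θ) :
    ∀ᵐ ω ∂P, ∃ B, ∀ t,
      ‖diffuse W α (signalNoise G θs θ (fun s => x s ω) fun s => y s ω) t‖ ≤ B := by
  obtain ⟨L, hL0, hL⟩ := h1.bounded
  have hr : ∀ t ω j, |G.logRatio θs θ j (x t ω) (y t ω j)| ≤ L := fun t ω j =>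
    hL j θs θ _ (h.mem_profiles hG hα t ω) _
  have hi : ∀ t ω j, |G.info θs θ j (x t ω)| ≤ L := fun t ω j =>
    hG.abs_info_le (h.mem_profiles hG hα t ω) (hL j θs θ _ (h.mem_profiles hG hα t ω))
  have hrm := h.measurable_logRatio (θ := θ) hG hα h1
  have him := h.measurable_info (θ := θ) hG hα h1
  refine ae_exists_norm_diffuse_le (ℱ := h.filtration) (K := L + L) hW hα.sq_summable
    (fun t ω => ?_) (fun t => ?_) fun t j => ?_
  · exact (pi_norm_le_iff_of_nonneg (add_pos hL0 hL0).le).2 fun j =>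
      (norm_sub_le _ _).trans (add_le_add (hr t ω j) (hi t ω j))
  · exact @measurable_pi_lambda Ω ι _ (history x y (t + 1)) _ _ fun j =>
      (hrm t j).sub ((him t j).mono (h.filtration.mono t.le_succ) le_rfl)
  · have hri : Integrable (fun ω => G.logRatio θs θ j (x t ω) (y t ω j)) P :=
      Integrable.of_bound ((hrm t j).mono (h.filtration.le _) le_rfl).aestronglyMeasurable L
        (Eventually.of_forall fun ω => hr t ω j)
    have hii : Integrable (fun ω => G.info θs θ j (x t ω)) P :=
      Integrable.of_bound ((him t j).mono (h.filtration.le t) le_rfl).aestronglyMeasurable L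
        (Eventually.of_forall fun ω => hi t ω j)
    have hcond : P[fun ω => G.info θs θ j (x t ω) | history x y t] = _ :=
      condExp_of_stronglyMeasurable (h.filtration.le t) (him t j).stronglyMeasurable hii
    filter_upwards [condExp_sub hri hii (history x y t), h.condExp_logRatio hG hα h1 t j]
      with ω hsub hmean
    exact hsub.trans (by rw [Pi.sub_apply, hmean, hcond, sub_self, Pi.zero_apply])

end Run

namespace Game

section BestResponse

variable {ι Θ τ : Type*} {d : ι → ℕ} {G : Game ι Θ d} {i : ι} {x : Profile d}
  {m : Θ → ℝ}

theorem update_mem_profiles [DecidableEq ι] (hx : x ∈ G.profiles)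
    {z : EuclideanSpace ℝ (Fin (d i))} (hz : z ∈ G.strat i) :
    Function.update x i z ∈ G.profiles :=
  (Function.forall_update_iff x fun k v => v ∈ G.strat k).2 ⟨hz, fun k _ => hx k⟩

variable [DecidableEq ι] [Fintype Θ]

theorem ConvexCosts.tendsto_expCost (h5 : G.ConvexCosts) {l : Filter τ} {ξ : τ → Profile d}
    {p : τ → Θ → ℝ} (hξ : ∀ t, ξ t ∈ G.profiles) (hx : x ∈ G.profiles) (hξx : Tendsto ξ l (𝓝 x))
    (hpm : Tendsto p l (𝓝 m)) :
    Tendsto (fun t => G.expCost i (ξ t) (p t)) l (𝓝 (G.expCost i x m)) :=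
  tendsto_finsetSum _ fun θ _ => (tendsto_pi_nhds.1 hpm θ).mul <|
    (h5.continuous i θ x hx).tendsto.comp <|
      tendsto_nhdsWithin_iff.2 ⟨hξx, Eventually.of_forall hξ⟩

theorem ConvexCosts.strictConvexOn_expCost (h5 : G.ConvexCosts) (hm : m ∈ stdSimplex ℝ Θ)
    (hx : x ∈ G.profiles) :
    StrictConvexOn ℝ (G.strat i) fun z => G.expCost i (Function.update x i z) m := by
  obtain ⟨θ₀, -, hθ₀⟩ := Finset.exists_lt_of_sum_lt (s := Finset.univ) (f := fun _ : Θ => (0 : ℝ))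
    (g := m) (by simp only [Finset.sum_const_zero, hm.2, zero_lt_one])
  have hconv := fun θ => h5.strictConvex i θ x hx
  refine ⟨(hconv θ₀).1, fun z hz z' hz' hne a b ha hb hab => ?_⟩
  have hlt := fun θ => (hconv θ).2 hz hz' hne ha hb hab
  simp only [expCost, smul_eq_mul, Finset.mul_sum, ← Finset.sum_add_distrib] at hlt ⊢
  refine Finset.sum_lt_sum (fun θ _ => ?_) ⟨θ₀, Finset.mem_univ θ₀, ?_⟩
  · linarith [mul_le_mul_of_nonneg_left (hlt θ).le (hm.1 θ)]
  · linarith [mul_lt_mul_of_pos_left (hlt θ₀) hθ₀]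

theorem ConvexCosts.bestResponse_nonempty (h5 : G.ConvexCosts) (hG : G.IsModel)
    (hx : x ∈ G.profiles) : (G.bestResponse i x m).Nonempty := by
  have hcost : ContinuousOn (fun z => G.expCost i (Function.update x i z) m) (G.strat i) :=
    continuousOn_iff_continuous_domRestrict.2 <| continuous_iff_continuousAt.2 fun z =>
      h5.tendsto_expCost (ξ := fun z : G.strat i => Function.update x i z)
        (fun z => update_mem_profiles hx z.2) (update_mem_profiles hx z.2)
        (tendsto_const_nhds.update i continuous_subtype_val.continuousAt) tendsto_const_nhds
  obtain ⟨z, hz, hmin⟩ := (hG.compact_strat i).exists_isMinOn ⟨x i, hx i⟩ hcost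
  exact ⟨z, hz, fun z' hz' => hmin hz'⟩

theorem ConvexCosts.bestResponse_subsingleton (h5 : G.ConvexCosts) (hm : m ∈ stdSimplex ℝ Θ)
    (hx : x ∈ G.profiles) : (G.bestResponse i x m).Subsingleton := fun _ hz _ hz' =>
  (h5.strictConvexOn_expCost hm hx).eq_of_isMinOn (fun _ hw => hz.2 _ hw)
    (fun _ hw => hz'.2 _ hw) hz.1 hz'.1

theorem ConvexCosts.tendsto_bestResponse (h5 : G.ConvexCosts) (hG : G.IsModel) {l : Filter τ}
    {ξ : τ → Profile d} {p : τ → Θ → ℝ} {ζ : τ → EuclideanSpace ℝ (Fin (d i))}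
    (hζ : ∀ t, ζ t ∈ G.bestResponse i (ξ t) (p t)) (hξ : ∀ t, ξ t ∈ G.profiles)
    (hx : x ∈ G.profiles) (hξx : Tendsto ξ l (𝓝 x)) (hm : m ∈ stdSimplex ℝ Θ)
    (hpm : Tendsto p l (𝓝 m)) {z : EuclideanSpace ℝ (Fin (d i))}
    (hz : z ∈ G.bestResponse i x m) : Tendsto ζ l (𝓝 z) := by
  rw [tendsto_iff_ultrafilter]
  intro U hU
  obtain ⟨w, hw, hζw⟩ := (hG.compact_strat i).ultrafilter_le_nhds' (U.map ζ)
    (Ultrafilter.mem_map.2 (Eventually.of_forall fun t => (hζ t).1))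
  have hcost : ∀ {v : τ → EuclideanSpace ℝ (Fin (d i))} {v₀ : EuclideanSpace ℝ (Fin (d i))},
      (∀ t, v t ∈ G.strat i) → v₀ ∈ G.strat i → Tendsto v U (𝓝 v₀) →
      Tendsto (fun t => G.expCost i (Function.update (ξ t) i (v t)) (p t)) U
        (𝓝 (G.expCost i (Function.update x i v₀) m)) := fun hv hv₀ hvU =>
    h5.tendsto_expCost (fun t => update_mem_profiles (hξ t) (hv t)) (update_mem_profiles hx hv₀)
      ((hξx.mono_left hU).update i hvU) (hpm.mono_left hU)
  have hwBR : w ∈ G.bestResponse i x m := ⟨hw, fun z' hz' =>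
    le_of_tendsto_of_tendsto' (hcost (fun t => (hζ t).1) hw hζw)
      (hcost (fun _ => hz') hz' tendsto_const_nhds) fun t => (hζ t).2 z' hz'⟩
  rw [h5.bestResponse_subsingleton hm hx hz hwBR]
  exact hζw

theorem IsNash.isBRSolution_const (h : G.IsNash m x) : G.IsBRSolution m fun _ => x := by
  refine fun t _ => ⟨h.1, fun i => ⟨x i, ⟨h.1 i, fun z hz => ?_⟩, ?_⟩⟩
  · rw [Function.update_eq_self]
    exact h.2 i z hz
  · rw [sub_self]
    exact hasDerivWithinAt_const t (Set.Ici 0) (x i)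

theorem BRConverges.exists_unique (h : G.BRConverges m) :
    ∃ xs, (∀ x', G.IsNash m x' ↔ x' = xs) ∧
      ∀ xbar, G.IsBRSolution m xbar → Tendsto xbar atTop (𝓝 xs) := by
  obtain ⟨xs, hxs, hsol⟩ := h
  exact ⟨xs, fun x' => ⟨fun hx' =>
    tendsto_nhds_unique tendsto_const_nhds (hsol _ hx'.isBRSolution_const), fun hx' => hx' ▸ hxs⟩,
    hsol⟩

theorem ConvexCosts.tendsto_time_average [Finite ι] {α : ℕ → ℝ} {ξ : ℕ → Profile d}
    {p : ℕ → ι → Θ → ℝ} {xs : Profile d} {g : Profile d → ℝ} (h5 : G.ConvexCosts) (hG : G.IsModel)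
    (hα : IsStepSize α) (hξ : ∀ t, ξ t ∈ G.profiles)
    (hupd : ∀ t i, ∃ z ∈ G.bestResponse i (ξ t) (p t i),
      ξ (t + 1) i = (1 - α t) • ξ t i + α t • z)
    (hm : m ∈ stdSimplex ℝ Θ) (hpm : ∀ i, Tendsto (fun t => p t i) atTop (𝓝 m))
    (hxs : xs ∈ G.profiles) (hsol : ∀ xbar, G.IsBRSolution m xbar → Tendsto xbar atTop (𝓝 xs))
    (hg : ContinuousOn g G.profiles) :
    Tendsto (fun T => (∑ t ∈ Finset.range T, α t * g (ξ t)) / clock α T) atTop (𝓝 (g xs)) := by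
  have := Fintype.ofFinite ι
  choose z hz hξz using hupd
  have hBR : ∀ q : Profile d, ∃ v : Profile d, q ∈ G.profiles →
      ∀ i, v i ∈ G.bestResponse i q m := fun q => by
    by_cases hq : q ∈ G.profiles
    · choose v hv using fun i => h5.bestResponse_nonempty hG (i := i) (m := m) hq
      exact ⟨v, fun _ => hv⟩
    · exact ⟨q, fun h => absurd h hq⟩
  choose F hF using hBR
  refine LearningGame.tendsto_time_average (z := z) (F := F) hα hG.isCompact_profiles hξ
    (fun t i => (hz t i).1) (fun t => ?_) (fun q hq => tendsto_pi_nhds.2 fun i => ?_) hxs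
    (fun φ hφ => hsol φ fun t ht => ⟨(hφ t ht).1, fun i => ?_⟩) hg
  · ext1 i
    rw [hξz, Pi.add_apply, Pi.smul_apply, Pi.sub_apply]
    module
  · exact h5.tendsto_bestResponse hG (fun t => hz t i) hξ hq
      (tendsto_comap.mono_left inf_le_right) hm ((hpm i).mono_left inf_le_left) (hF q hq i)
  · exact ⟨F (φ t) i, hF _ (hφ t ht).1 i, hasDerivWithinAt_pi.1 (hφ t ht).2 i⟩

end BestResponse

end Game

section LogOdds

/-- The log-odds of `θs` against `θ` under a belief `p`. -/
def logOdds {Θ : Type*} (p : Θ → ℝ) (θs θ : Θ) : ℝ := Real.log (p θs / p θ)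

variable {Θ τ : Type*} {p : Θ → ℝ} {θs : Θ}

theorem exp_neg_logOdds (hp : ∀ θ, 0 < p θ) (θs θ : Θ) :
    Real.exp (-logOdds p θs θ) = p θ / p θs := by
  rw [logOdds, ← Real.log_inv, inv_div, Real.exp_log (div_pos (hp θ) (hp θs))]

variable [Fintype Θ] [DecidableEq Θ]

theorem eq_one_div_one_add_sum_exp_neg_logOdds (hp : ∀ θ, 0 < p θ) (hsum : ∑ θ, p θ = 1)
    (θs : Θ) :
    p θs = 1 / (1 + ∑ θ ∈ Finset.univ.erase θs, Real.exp (-logOdds p θs θ)) := by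
  have htotal : p θs * (1 + ∑ θ ∈ Finset.univ.erase θs, Real.exp (-logOdds p θs θ)) = 1 := by
    simp only [exp_neg_logOdds hp, ← Finset.sum_div]
    rw [mul_add, mul_one, mul_div_cancel₀ _ (hp θs).ne',
      Finset.add_sum_erase _ p (Finset.mem_univ θs), hsum]
  exact eq_one_div_of_mul_eq_one_left htotal

theorem one_div_one_add_sum_exp_neg_le (hp : ∀ θ, 0 < p θ) (hsum : ∑ θ, p θ = 1) {c : Θ → ℝ}
    (hc : ∀ θ, c θ ≤ logOdds p θs θ) :
    1 / (1 + ∑ θ ∈ Finset.univ.erase θs, Real.exp (-c θ)) ≤ p θs := by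
  rw [eq_one_div_one_add_sum_exp_neg_logOdds hp hsum θs]
  gcongr with θ
  exact hc θ

theorem eventually_one_div_one_add_sum_exp_le {ι : Type*} [Finite ι] {l : Filter τ}
    {p : τ → ι → Θ → ℝ} (hp : ∀ t i θ, 0 < p t i θ) (hsum : ∀ t i, ∑ θ, p t i θ = 1) {S : τ → ℝ}
    (hS : Tendsto S l atTop) {Z : Θ → ℝ}
    (hrate : ∀ i θ, Tendsto (fun t => 1 / S t * logOdds (p t i) θs θ) l (𝓝 (Z θ)))
    {ε : ℝ} (hε : 0 < ε) :
    ∀ᶠ t in l, ∀ i,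
      1 / (1 + ∑ θ ∈ Finset.univ.erase θs, Real.exp (-S t * (Z θ - ε))) ≤ p t i θs := by
  have hlower : ∀ᶠ t in l, ∀ i θ, Z θ - ε < 1 / S t * logOdds (p t i) θs θ :=
    eventually_all.2 fun i => eventually_all.2 fun θ =>
      (hrate i θ).eventually (lt_mem_nhds (sub_lt_self _ hε))
  filter_upwards [hlower, hS.eventually_gt_atTop 0] with t ht hSt i
  simp only [neg_mul]
  refine one_div_one_add_sum_exp_neg_le (hp t i) (hsum t i) fun θ => ?_
  rw [mul_comm, ← le_div_iff₀ hSt, ← one_div_mul_eq_div]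
  exact (ht i θ).le

theorem tendsto_single_of_tendsto_logOdds {l : Filter τ} {p : τ → Θ → ℝ} (hp : ∀ t θ, 0 < p t θ)
    (hsum : ∀ t, ∑ θ, p t θ = 1)
    (h : ∀ θ, θ ≠ θs → Tendsto (fun t => logOdds (p t) θs θ) l atTop) :
    Tendsto p l (𝓝 (Pi.single θs 1)) := by
  have hexp : ∀ θ, θ ≠ θs → Tendsto (fun t => Real.exp (-logOdds (p t) θs θ)) l (𝓝 0) :=
    fun θ hθ => Real.tendsto_exp_neg_atTop_nhds_zero.comp (h θ hθ)
  refine tendsto_pi_nhds.2 fun θ => ?_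
  rcases eq_or_ne θ θs with rfl | hθ
  · have hlim := (tendsto_finsetSum (Finset.univ.erase θ) fun θ' hθ' =>
      hexp θ' (Finset.ne_of_mem_erase hθ')).const_add 1
    simp only [Finset.sum_const_zero, add_zero] at hlim
    have hinv := hlim.inv₀ one_ne_zero
    rw [Pi.single_eq_same, ← inv_one]
    refine hinv.congr fun t => ?_
    rw [eq_one_div_one_add_sum_exp_neg_logOdds (hp t) (hsum t) θ, one_div]
  · rw [Pi.single_eq_of_ne hθ]
    refine squeeze_zero (fun t => (hp t θ).le) (fun t => ?_) (hexp θ hθ)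
    rw [exp_neg_logOdds (hp t)]
    exact le_div_self (hp t θ).le (hp t θs)
      (mem_Icc_of_mem_stdSimplex ⟨fun θ => (hp t θ).le, hsum t⟩ θs).2

end LogOdds

section Beliefs

variable {ι Θ : Type*} [Fintype ι] [Fintype Θ] [Nonempty Θ] {d : ι → ℕ}

theorem pool_pos (w : ι → ℝ) (b : ι → Θ → ℝ) (θ : Θ) : 0 < pool w b θ :=
  div_pos (Real.exp_pos _) (Finset.sum_pos (fun _ _ => Real.exp_pos _) Finset.univ_nonempty)

theorem sum_pool (w : ι → ℝ) (b : ι → Θ → ℝ) : ∑ θ, pool w b θ = 1 := by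
  simp only [pool, ← Finset.sum_div]
  exact div_self (Finset.sum_pos (fun _ _ => Real.exp_pos _) Finset.univ_nonempty).ne'

theorem logOdds_pool (w : ι → ℝ) {b : ι → Θ → ℝ} (hb : ∀ j θ, 0 < b j θ) (θ θ' : Θ) :
    logOdds (pool w b) θ θ' = ∑ j, w j * logOdds (b j) θ θ' := by
  have hsum : (∑ θ', Real.exp (∑ j, w j * Real.log (b j θ'))) ≠ 0 :=
    (Finset.sum_pos (fun _ _ => Real.exp_pos _) Finset.univ_nonempty).ne'
  rw [logOdds, pool, pool, div_div_div_cancel_right₀ hsum, ← Real.exp_sub, Real.log_exp,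
    ← Finset.sum_sub_distrib]
  exact Finset.sum_congr rfl fun j _ => by
    rw [← mul_sub, logOdds, Real.log_div (hb j θ).ne' (hb j θ').ne']

theorem posterior_pos (a : ℝ) {ℓ m : Θ → ℝ} (hℓ : ∀ θ, 0 < ℓ θ) (hm : ∀ θ, 0 < m θ) (θ : Θ) :
    0 < posterior a ℓ m θ :=
  have hprod : ∀ θ, 0 < ℓ θ ^ a * m θ := fun θ => mul_pos (Real.rpow_pos_of_pos (hℓ θ) a) (hm θ)
  div_pos (hprod θ) (Finset.sum_pos (fun θ _ => hprod θ) Finset.univ_nonempty)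

theorem logOdds_posterior (a : ℝ) {ℓ m : Θ → ℝ} (hℓ : ∀ θ, 0 < ℓ θ) (hm : ∀ θ, 0 < m θ)
    (θ θ' : Θ) :
    logOdds (posterior a ℓ m) θ θ' = logOdds m θ θ' + a * logOdds ℓ θ θ' := by
  have hpow : ∀ θ, 0 < ℓ θ ^ a := fun θ => Real.rpow_pos_of_pos (hℓ θ) a
  have hsum : (∑ θ', ℓ θ' ^ a * m θ') ≠ 0 :=
    (Finset.sum_pos (fun θ _ => mul_pos (hpow θ) (hm θ)) Finset.univ_nonempty).ne'
  rw [logOdds, posterior, posterior, div_div_div_cancel_right₀ hsum, mul_div_mul_comm,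
    ← Real.div_rpow (hℓ θ).le (hℓ θ').le,
    Real.log_mul (Real.rpow_pos_of_pos (div_pos (hℓ θ) (hℓ θ')) a).ne'
      (div_pos (hm θ) (hm θ')).ne', Real.log_rpow (div_pos (hℓ θ) (hℓ θ')), add_comm]
  rfl

variable {G : Game ι Θ d} {W : Matrix ι ι ℝ} {α : ℕ → ℝ} {x : ℕ → Profile d} {y : ℕ → ι → ℝ}

theorem belief_pos (t : ℕ) (i : ι) (θ : Θ) : 0 < belief G W α x y t i θ := by
  cases t with
  | zero => exact one_div_pos.2 (Nat.cast_pos.2 Fintype.card_pos)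
  | succ t => exact pool_pos _ _ θ

theorem sum_belief (t : ℕ) (i : ι) : ∑ θ, belief G W α x y t i θ = 1 := by
  cases t with
  | zero => simp [belief]
  | succ t => exact sum_pool _ _

theorem logOdds_belief_eq_diffuse (hf : ∀ t j θ, 0 < G.f j (y t j) (x t) θ) (θ θ' : Θ) (t : ℕ) :
    (fun i => logOdds (belief G W α x y t i) θ θ') =
      diffuse W α (fun s j => G.logRatio θ θ' j (x s) (y s j)) t := by
  induction t with
  | zero =>
    ext i
    simp [logOdds, belief, diffuse]
  | succ t ih =>
    ext i
    rw [belief, diffuse, ← ih, logOdds_pool _ fun j => posterior_pos _ (hf t j) (belief_pos t j)]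
    exact Finset.sum_congr rfl fun j _ => by
      rw [logOdds_posterior _ (hf t j) (belief_pos t j)]
      rfl

end Beliefs

section Asymptotics

theorem tendsto_comp_succ_sub_of_continuousOn {V E : Type*} [SeminormedAddCommGroup V]
    [SeminormedAddCommGroup E] {X : Set V} (hX : IsCompact X) {g : V → E} (hg : ContinuousOn g X)
    {x : ℕ → V} (hx : ∀ t, x t ∈ X) (hdx : Tendsto (fun t => x (t + 1) - x t) atTop (𝓝 0)) :
    Tendsto (fun t => g (x (t + 1)) - g (x t)) atTop (𝓝 0) := by
  rw [tendsto_zero_iff_norm_tendsto_zero] at hdx ⊢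
  simp only [← dist_eq_norm] at hdx ⊢
  have hpair : Tendsto (fun t => (x (t + 1), x t)) atTop (uniformity V ⊓ 𝓟 (X ×ˢ X)) :=
    tendsto_inf.2 ⟨tendsto_uniformity_iff_dist_tendsto_zero.2 hdx,
      tendsto_principal.2 (Eventually.of_forall fun t => ⟨hx (t + 1), hx t⟩)⟩
  exact tendsto_uniformity_iff_dist_tendsto_zero.1
    (Tendsto.comp (hX.uniformContinuousOn_of_continuous hg) hpair)

theorem sum_Icc_one_eq_clock_sub (α : ℕ → ℝ) (T : ℕ) :
    ∑ t ∈ Finset.Icc 1 T, α t = clock α (T + 1) - α 0 := by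
  rw [clock, Finset.sum_range_eq_add_Ico _ T.succ_pos, add_sub_cancel_left]
  rfl

namespace IsStepSize

variable {α : ℕ → ℝ}

theorem tendsto_sub_of_isCompact {V : Type*} [NormedAddCommGroup V] [NormedSpace ℝ V]
    (hα : IsStepSize α) {X : Set V} (hX : IsCompact X) {x z : ℕ → V} (hxX : ∀ t, x t ∈ X)
    (hzX : ∀ t, z t ∈ X) (hx : ∀ t, x (t + 1) = (1 - α t) • x t + α t • z t) :
    Tendsto (fun t => x (t + 1) - x t) atTop (𝓝 0) := by
  obtain ⟨C, hC⟩ := exists_forall_norm_sub_le hX hxX hzX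
  have hstep : ∀ t, x (t + 1) - x t = α t • (z t - x t) := fun t => by
    rw [hx]
    module
  simp only [hstep]
  exact hα.tendsto_zero.zero_smul_isBoundedUnder_le (isBoundedUnder_of ⟨C, hC⟩)

theorem tendsto_sum_Icc_one (hα : IsStepSize α) :
    Tendsto (fun T => ∑ t ∈ Finset.Icc 1 T, α t) atTop atTop := by
  simp only [sum_Icc_one_eq_clock_sub, sub_eq_add_neg]
  exact tendsto_atTop_add_const_right _ _ (hα.tendsto_clock.comp (tendsto_add_atTop_nat 1))

theorem tendsto_one_div_sum_Icc_one_mul (hα : IsStepSize α) {a : ℕ → ℝ} {l : ℝ}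
    (ha : Tendsto (fun T => a T / clock α T) atTop (𝓝 l)) :
    Tendsto (fun T => 1 / (∑ t ∈ Finset.Icc 1 T, α t) * a (T + 1)) atTop (𝓝 l) := by
  have hratio := (hα.tendsto_sum_Icc_one.const_div_atTop (α 0)).const_add 1
  have hlim := (ha.comp (tendsto_add_atTop_nat 1)).mul hratio
  rw [add_zero, mul_one] at hlim
  refine hlim.congr' ?_
  filter_upwards [hα.tendsto_sum_Icc_one.eventually_gt_atTop 0] with T hT
  have hclock : clock α (T + 1) = ∑ t ∈ Finset.Icc 1 T, α t + α 0 := by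
    rw [sum_Icc_one_eq_clock_sub, sub_add_cancel]
  have hpos := add_pos hT (hα.mem_Ioo 0).1
  rw [Function.comp_apply, hclock]
  field_simp

end IsStepSize

end Asymptotics

section TypicalPaths

variable {ι Θ : Type*} [Fintype ι] [DecidableEq ι] [Fintype Θ] {d : ι → ℕ} {G : Game ι Θ d}
  {E : ι → ι → Prop} {W : Matrix ι ι ℝ} {α : ℕ → ℝ} {θs : Θ} {x : ℕ → Profile d} {y : ℕ → ι → ℝ}

/-- The paths of the learning algorithm to which the convergence argument applies: every observed
signal has positive likelihood, and the diffused noise of the signals stays bounded. Almost every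
path of a run is of this kind. -/
structure IsTypicalPath (G : Game ι Θ d) (W : Matrix ι ι ℝ) (α : ℕ → ℝ) (θs : Θ)
    (x : ℕ → Profile d) (y : ℕ → ι → ℝ) : Prop where
  mem_profiles : ∀ t, x t ∈ G.profiles
  strategy_update : ∀ t i, ∃ z ∈ G.bestResponse i (x t) (belief G W α x y (t + 1) i),
    x (t + 1) i = (1 - α t) • x t i + α t • z
  f_pos : ∀ t j θ, 0 < G.f j (y t j) (x t) θ
  noise_bounded : ∀ θ, ∃ B, ∀ t, ‖diffuse W α (signalNoise G θs θ x y) t‖ ≤ B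

theorem IsRun.ae_isTypicalPath {Ω : Type*} [MeasurableSpace Ω] {P : Measure Ω}
    [IsProbabilityMeasure P] {x : ℕ → Ω → Profile d} {y : ℕ → Ω → ι → ℝ}
    (h : IsRun P G W α θs x y) (hG : G.IsModel) (hα : IsStepSize α) (h1 : G.BoundedInformation)
    (hW : W ∈ doublyStochastic ℝ ι) :
    ∀ᵐ ω ∂P, IsTypicalPath G W α θs (fun s => x s ω) fun s => y s ω := by
  filter_upwards [h.ae_forall_f_pos hG hα h1,
    ae_all_iff.2 (h.ae_exists_norm_diffuse_signalNoise_le hG hα h1 hW)] with ω hpos hnoise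
  exact ⟨fun t => h.mem_profiles hG hα t ω, h.strategy_update ω, hpos, hnoise⟩

namespace IsTypicalPath

theorem tendsto_sub (h : IsTypicalPath G W α θs x y) (hG : G.IsModel) (hα : IsStepSize α) :
    Tendsto (fun t => x (t + 1) - x t) atTop (𝓝 0) := by
  choose z hz hxz using h.strategy_update
  exact hα.tendsto_sub_of_isCompact hG.isCompact_profiles h.mem_profiles
    (fun t i => (hz t i).1) fun t => funext (hxz t)

theorem tendsto_diffuse_info_sub [Nonempty ι] (h : IsTypicalPath G W α θs x y) (hG : G.IsModel)
    (hα : IsStepSize α) (h1 : G.BoundedInformation) (h3 : IsNetwork E W) (θ : Θ) (i : ι) :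
    Tendsto (fun T => (diffuse W α (fun t j => G.info θs θ j (x t)) T i -
      ∑ t ∈ Finset.range T, α t * 𝔼 j, G.info θs θ j (x t)) / clock α T) atTop (𝓝 0) := by
  have hcont : ContinuousOn (fun p j => G.info θs θ j p) G.profiles :=
    continuousOn_pi.2 fun j => hG.continuousOn_info h1
  obtain ⟨C, hC⟩ := hG.isCompact_profiles.exists_bound_of_continuousOn hcont
  have hlim := tendsto_pi_nhds.1 (h3.tendsto_diffuse_sub_average hα
    (fun t => hC _ (h.mem_profiles t)) (tendsto_comp_succ_sub_of_continuousOn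
      hG.isCompact_profiles hcont h.mem_profiles (h.tendsto_sub hG hα))) i
  refine hlim.congr fun T => ?_
  simp only [Matrix.sub_mulVec, Matrix.one_mulVec, averagingMatrix_mulVec,
    mulVec_diffuse_of_mul_eq (averagingMatrix_mul h3.colStochastic), Pi.smul_apply, Pi.sub_apply,
    Finset.sum_apply, smul_eq_mul, inv_mul_eq_div]

variable [Nonempty Θ]

theorem tendsto_logOdds_sub [Nonempty ι] (h : IsTypicalPath G W α θs x y) (hG : G.IsModel)
    (hα : IsStepSize α) (h1 : G.BoundedInformation) (h3 : IsNetwork E W) (θ : Θ) (i : ι) :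
    Tendsto (fun T => (logOdds (belief G W α x y T i) θs θ -
      ∑ t ∈ Finset.range T, α t * 𝔼 j, G.info θs θ j (x t)) / clock α T) atTop (𝓝 0) := by
  obtain ⟨B, hB⟩ := h.noise_bounded θ
  have hnoise : Tendsto (fun T => diffuse W α (signalNoise G θs θ x y) T i / clock α T) atTop
      (𝓝 0) :=
    hα.tendsto_clock.inv_tendsto_atTop.zero_mul_isBoundedUnder_le
      (isBoundedUnder_of ⟨B, fun T => (norm_le_pi_norm _ i).trans (hB T)⟩) |>.congr
      fun T => inv_mul_eq_div _ _
  have hlim := (h.tendsto_diffuse_info_sub hG hα h1 h3 θ i).add hnoise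
  rw [add_zero] at hlim
  refine hlim.congr fun T => ?_
  have hsplit : (fun s j => G.logRatio θs θ j (x s) (y s j)) =
      (fun s j => G.info θs θ j (x s)) + signalNoise G θs θ x y := by
    ext s j
    exact (add_sub_cancel _ _).symm
  rw [congrFun (logOdds_belief_eq_diffuse h.f_pos θs θ T) i, hsplit, diffuse_add, Pi.add_apply,
    ← add_div, add_sub_right_comm]

theorem tendsto_logOdds_atTop [Nonempty ι] (h : IsTypicalPath G W α θs x y) (hG : G.IsModel)
    (hα : IsStepSize α) (h1 : G.BoundedInformation) (h2 : G.Identifiable θs)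
    (h3 : IsNetwork E W) {θ : Θ} (hθ : θ ≠ θs) (i : ι) :
    Tendsto (fun T => logOdds (belief G W α x y T i) θs θ) atTop atTop := by
  obtain ⟨c, hc, hinfo⟩ := h2.exists_forall_le_average_info hG h1 hθ
  refine tendsto_atTop_mono' atTop ?_ (hα.tendsto_clock.const_mul_atTop (half_pos hc))
  filter_upwards [(h.tendsto_logOdds_sub hG hα h1 h3 θ i).eventually
      (lt_mem_nhds (neg_lt_zero.2 (half_pos hc))),
    hα.tendsto_clock.eventually_gt_atTop 0] with T hT hT0
  rw [lt_div_iff₀ hT0] at hT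
  have hdrift : clock α T * c ≤ ∑ t ∈ Finset.range T, α t * 𝔼 j, G.info θs θ j (x t) := by
    rw [clock, Finset.sum_mul]
    exact Finset.sum_le_sum fun t _ =>
      mul_le_mul_of_nonneg_left (hinfo _ (h.mem_profiles t)) (hα.nonneg t)
  linarith

theorem tendsto_belief [Nonempty ι] [DecidableEq Θ] (h : IsTypicalPath G W α θs x y)
    (hG : G.IsModel) (hα : IsStepSize α) (h1 : G.BoundedInformation) (h2 : G.Identifiable θs)
    (h3 : IsNetwork E W) (i : ι) :
    Tendsto (fun t => belief G W α x y t i) atTop (𝓝 (Pi.single θs 1)) :=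
  tendsto_single_of_tendsto_logOdds (fun t => belief_pos t i) (fun t => sum_belief t i)
    fun _ hθ => h.tendsto_logOdds_atTop hG hα h1 h2 h3 hθ i

theorem tendsto_logOdds_div_sum [Nonempty ι] (h : IsTypicalPath G W α θs x y) (hG : G.IsModel)
    (hα : IsStepSize α) (h1 : G.BoundedInformation) (h3 : IsNetwork E W) (h5 : G.ConvexCosts)
    {m : Θ → ℝ} (hm : m ∈ stdSimplex ℝ Θ)
    (hbm : ∀ i, Tendsto (fun t => belief G W α x y t i) atTop (𝓝 m)) {xs : Profile d}
    (hxs : xs ∈ G.profiles) (hsol : ∀ xbar, G.IsBRSolution m xbar → Tendsto xbar atTop (𝓝 xs))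
    (i : ι) (θ : Θ) :
    Tendsto (fun T : ℕ => 1 / (∑ t ∈ Finset.Icc 1 T, α t) *
      logOdds (belief G W α x y (T + 1) i) θs θ) atTop
      (𝓝 (G.networkDivergence xs θs θ).toReal) := by
  have htime := h5.tendsto_time_average hG hα h.mem_profiles h.strategy_update hm
    (fun i => (hbm i).comp (tendsto_add_atTop_nat 1)) hxs hsol
    (hG.continuousOn_average_info h1 (θs := θs) (θ := θ))
  have hlim := (h.tendsto_logOdds_sub hG hα h1 h3 θ i).add htime
  simp only [zero_add, ← add_div, sub_add_cancel] at hlim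
  rw [hG.toReal_networkDivergence h1 hxs]
  exact hα.tendsto_one_div_sum_Icc_one_mul hlim

end IsTypicalPath

end TypicalPaths

end LearningGame

end

theorem theorem3 {ι Θ Ω : Type*} [Fintype ι] [DecidableEq ι] [Nonempty ι]
    [Fintype Θ] [DecidableEq Θ] [MeasurableSpace Ω]
    (P : Measure Ω) [IsProbabilityMeasure P] {d : ι → ℕ}
    (G : Game ι Θ d) (θs : Θ) (E : ι → ι → Prop) (W : Matrix ι ι ℝ) (α : ℕ → ℝ)
    (x : ℕ → Ω → Profile d) (y : ℕ → Ω → ι → ℝ) (μ : ℕ → Ω → ι → Θ → ℝ)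
    (hG : G.IsModel)
    (h1 : G.BoundedInformation)
    (h2 : G.Identifiable θs)
    (h3 : IsNetwork E W)
    (h4 : IsStepSize α)
    (h5 : G.ConvexCosts)
    (hrun : IsRun P G W α θs x y)
    (hμ : ∀ t ω, μ t ω = belief G W α (fun s => x s ω) (fun s => y s ω) t)
    (h6 : ∀ᵐ ω ∂P, ∀ m : Θ → ℝ,
      (∀ i θ, Tendsto (fun t => μ t ω i θ) atTop (𝓝 (m θ))) → G.BRConverges m) :
    ∀ᵐ ω ∂P, ∃ m ∈ stdSimplex ℝ Θ, ∃ xs : Profile d,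
      -- `m` is the common limit of the beliefs
      (∀ i θ, Tendsto (fun t => μ t ω i θ) atTop (𝓝 (m θ))) ∧
      -- `xs` is the Nash equilibrium of the game with the common belief `m`
      (∀ x', G.IsNash m x' ↔ x' = xs) ∧
      (∀ θ, G.networkDivergence xs θs θ ≠ ⊤) ∧
      (∀ i θ, Tendsto
        (fun T : ℕ => 1 / (∑ t ∈ Finset.Icc 1 T, α t) *
          Real.log (μ (T + 1) ω i θs / μ (T + 1) ω i θ))
        atTop (𝓝 (G.networkDivergence xs θs θ).toReal)) ∧
      (∀ θ, θ ≠ θs → 0 < (G.networkDivergence xs θs θ).toReal) ∧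
      (∀ i, Tendsto (fun t => μ t ω i θs) atTop (𝓝 1)) ∧
      (∀ ε : ℝ, 0 < ε → ∃ T' : ℕ, ∀ T ≥ T', ∀ i,
        1 / (1 + ∑ θ ∈ Finset.univ.erase θs,
          Real.exp (-(∑ t ∈ Finset.Icc 1 T, α t) *
            ((G.networkDivergence xs θs θ).toReal - ε))) ≤ μ (T + 1) ω i θs ∧
        μ (T + 1) ω i θs ≤ 1) := by
  have : Nonempty Θ := ⟨θs⟩
  obtain rfl : μ = fun t ω => belief G W α (fun s => x s ω) (fun s => y s ω) t := funext₂ hμ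
  filter_upwards [hrun.ae_isTypicalPath hG h4 h1 h3.doublyStochastic, h6] with ω hω hBR
  have hm : Pi.single θs 1 ∈ stdSimplex ℝ Θ := single_mem_stdSimplex ℝ θs
  have hlim := hω.tendsto_belief hG h4 h1 h2 h3
  have hbelief := fun i => tendsto_pi_nhds.1 (hlim i)
  obtain ⟨xs, hnash, hsol⟩ := (hBR _ hbelief).exists_unique
  have hxs : xs ∈ G.profiles := ((hnash xs).2 rfl).1
  have hrate := hω.tendsto_logOdds_div_sum hG h4 h1 h3 h5 hm hlim hxs hsol
  refine ⟨_, hm, xs, hbelief, hnash, fun θ => hG.networkDivergence_ne_top h1 hxs, hrate,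
    fun θ hθ => h2.toReal_networkDivergence_pos hG h1 hθ hxs, fun i => ?_, fun ε hε => ?_⟩
  · simpa only [Pi.single_eq_same] using hbelief i θs
  · obtain ⟨T', hT'⟩ := eventually_atTop.1 <| eventually_one_div_one_add_sum_exp_le
      (fun T i => belief_pos (T + 1) i) (fun T i => sum_belief (T + 1) i)
      h4.tendsto_sum_Icc_one hrate hε
    exact ⟨T', fun T hT i => ⟨hT' T hT i, (mem_Icc_of_mem_stdSimplex
      ⟨fun θ => (belief_pos (T + 1) i θ).le, sum_belief (T + 1) i⟩ θs).2⟩⟩
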